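/- Signals and systems. Let $\mathcal S^m$ be the set of functions $u:[0,\infty)\to\mathbb R^m$ that are piecewise continuous and right-continuous. State trajectories are continuous on $[0,\infty)$ with a right-derivative at each $t\ge 0$ that is again a signal (an element of some $\mathcal S^n$). $\mathbb S^n$ denotes the real symmetric $n\times n$ matrices, $\succ 0$, $\prec 0$, $\succeq 0$ refer to definiteness of symmetric matrices, and $(\bullet)^TQR:=R^TQR$. Uncertainty. Fix $P_0=\begin{pmatrix}q&s\\ s&r\end{pmatrix}\in\mathbb S^2$ with $r\le 0$. For $z\in\mathcal S^1$ let $\Delta_{\rm dy}(z)\subset\mathcal S^1$ be the set of all $w=\delta z$, where $\delta$ is a stable (real rational, proper, scalar, of any degree) transfer function with $$\begin{pmatrix}1\\ \delta(i\omega)\end{pmatrix}^*P_0\begin{pmatrix}1\\ \delta(i\omega)\end{pmatrix}>0\quad\text{for all }\omega\in\mathbb R\cup\{\infty\},$$ and $w=\delta z$ is the response with zero initial condition to the input $z$ of a minimal realization of $\delta$ (whose state matrix is Hurwitz). Loop. Consider the uncertain interconnection $$\begin{pmatrix}\dot x\\ z\\ e\end{pmatrix}=\begin{pmatrix}A&B&B_d\\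 C&D&D_d\\ C_e&D_e&D_{ed}\end{pmatrix}\begin{pmatrix}x\\ w\\ d\end{pmatrix},\qquad w\in\Delta_{\rm dy}(z),$$ with scalar signals $w,z$ and vector-valued signals $d,e$, and a performance matrix $P_p=\begin{pmatrix}Q_p&S_p\\ S_p^T&R_p\end{pmatrix}=P_p^T$ with $Q_p\succeq 0$, partitioned according to $(e,d)$. Its trajectories are all tuples of signals $(x,w,z,d,e)$ that satisfy these relations on $[0,\infty)$, with arbitrary $x(0)$. Filter. Let $\psi$ be a stable $l\times 1$ transfer matrix that has full column rank on $i\mathbb R\cup\{\infty\}$, with a minimal realization $(A_\psi,B_\psi,C_\psi,D_\psi)$ (so $A_\psi$ is Hurwitz), and let $\Psi=\operatorname{diag}(\psi,\psi)$ have the realization $\bullet_\Psi=\operatorname{diag}(\bullet_\psi,\bullet_\psi)$ for $\bullet\in\{A,B,C,D\}$, with the columns of $B_\Psi=(B_{\Psi_1}\ B_{\Psi_2})$ and $D_\Psi=(D_{\Psi_1}\ D_{\Psi_2})$ partitioned according to $(z,w)$. Statement. (a) Let $X=X^T=\begin{pmatrix}X_1&X_{12}\\ X_{12}^T&X_2\end{pmatrix}$,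 $K=K^T$ and $M\in\mathbb S^l$ be such that $P:=P_0\otimes M$ and $Z:=P_0\otimes K$ satisfy the coupling condition $$\begin{pmatrix}X_1+Z&X_{12}\\ X_{12}^T&X_2\end{pmatrix}\succ 0,\tag{pos}$$ the performance LMI $$(\bullet)^T\begin{pmatrix}0&X\\ X&0\end{pmatrix}\begin{pmatrix}A_\Psi&B_{\Psi_1}C&B_{\Psi_1}D+B_{\Psi_2}&B_{\Psi_1}D_d\\ 0&A&B&B_d\\ I&0&0&0\\ 0&I&0&0\end{pmatrix}+(\bullet)^TP\begin{pmatrix}C_\Psi&D_{\Psi_1}C&D_{\Psi_1}D+D_{\Psi_2}&D_{\Psi_1}D_d\end{pmatrix}+(\bullet)^TP_p\begin{pmatrix}0&C_e&D_e&D_{ed}\\ 0&0&0&I\end{pmatrix}\prec 0,\tag{lmifp}$$ and $$\begin{pmatrix}A_\psi&B_\psi\\ I&0\end{pmatrix}^T\begin{pmatrix}0&K\\ K&0\end{pmatrix}\begin{pmatrix}A_\psi&B_\psi\\ I&0\end{pmatrix}\prec\begin{pmatrix}C_\psi&D_\psi\end{pmatrix}^TM\begin{pmatrix}C_\psi&D_\psi\end{pmatrix}.\tag{lmiK}$$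 Then $E(X,Z):=X_2-X_{12}^T(X_1+Z)^{-1}X_{12}\succ 0$, and all trajectories of the loop satisfy $$x(T)^TE(X,Z)x(T)+\int_0^T\begin{pmatrix}e(t)\\ d(t)\end{pmatrix}^TP_p\begin{pmatrix}e(t)\\ d(t)\end{pmatrix}dt\le x(0)^TX_2x(0)\quad\text{for all }T\ge 0.\tag{rp}$$ (b) The test is convex, with the terminal cost matrix $Z=P_0\otimes K$ as a free variable: the set of all symmetric triples $(X,K,M)$ that satisfy (pos), (lmifp) and (lmiK) for $P=P_0\otimes M$ and $Z=P_0\otimes K$ is convex. -/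

import Mathlib

open Set Filter Topology

namespace RobustIQC

noncomputable section

/-! ## Signals and linear systems -/

/-- The signal space `𝒮`: functions on the time set `[0, ∞)` that are right-continuous and
piecewise continuous (finitely many discontinuities in bounded intervals, with left limits).
Signals are represented as functions on `ℝ` whose values at negative times play no role. -/
structure IsSignal {ι : Type*} (u : ℝ → ι → ℝ) : Prop where
  rightContinuous : ∀ t, 0 ≤ t → ContinuousWithinAt u (Ici t) t
  leftLimit : ∀ t, 0 < t → ∃ a : ι → ℝ, Tendsto u (𝓝[<] t) (𝓝 a)
  finite_discontinuities : ∀ T, 0 < T → {t | t ∈ Ioo 0 T ∧ ¬ ContinuousAt u t}.Finite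

/-- `x` is a state trajectory with right-derivative `v`: it is continuous on `[0, ∞)`, has the
right-derivative `v t` at each `t ≥ 0`, and `v` is a signal. -/
structure IsStateTrajectory {ι : Type*} [Fintype ι] (x v : ℝ → ι → ℝ) : Prop where
  continuousOn : ContinuousOn x (Ici 0)
  hasRightDeriv : ∀ t, 0 ≤ t → HasDerivWithinAt x (v t) (Ici t) t
  isSignal_deriv : IsSignal v

/-- A linear system `ẋ = A x + B u`, `y = C x + D u` with real matrices; the index types are those
of the state, the input and the output. -/
structure LinSys (σ μ κ : Type*) where
  A : Matrix σ σ ℝ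
  B : Matrix σ μ ℝ
  C : Matrix κ σ ℝ
  D : Matrix κ μ ℝ

/-- All complex eigenvalues of the real matrix `A` have negative real part. -/
def IsHurwitz {σ : Type*} [Fintype σ] [DecidableEq σ] (A : Matrix σ σ ℝ) : Prop :=
  ∀ a ∈ spectrum ℂ (A.map Complex.ofReal), a.re < 0

namespace LinSys

variable {σ μ κ : Type*} [Fintype σ] [DecidableEq σ] [Fintype μ] [Fintype κ]

/-- The transfer matrix `C (s I - A)⁻¹ B + D` at `s ∈ ℂ`. -/
def transfer (G : LinSys σ μ κ) (s : ℂ) : Matrix κ μ ℂ :=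
  G.C.map Complex.ofReal * (s • (1 : Matrix σ σ ℂ) - G.A.map Complex.ofReal)⁻¹ *
    G.B.map Complex.ofReal + G.D.map Complex.ofReal

/-- The value of the transfer matrix at `s = ∞`. -/
def transferInfty (G : LinSys σ μ κ) : Matrix κ μ ℂ := G.D.map Complex.ofReal

/-- Kalman's condition: the columns of `B, A B, …, A ^ (n - 1) B` span the state space. -/
def IsControllable (G : LinSys σ μ κ) : Prop :=
  Submodule.span ℝ {x : σ → ℝ | ∃ i < Fintype.card σ, ∃ u : μ → ℝ, x = (G.A ^ i * G.B).mulVec u} = ⊤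

/-- Kalman's condition: `C, C A, …, C A ^ (n - 1)` have no common nonzero kernel vector. -/
def IsObservable (G : LinSys σ μ κ) : Prop :=
  ∀ x : σ → ℝ, (∀ i < Fintype.card σ, (G.C * G.A ^ i).mulVec x = 0) → x = 0

/-- A realization is minimal if it is controllable and observable. -/
def IsMinimal (G : LinSys σ μ κ) : Prop := G.IsControllable ∧ G.IsObservable

/-- The transfer matrix has full column rank on the extended imaginary axis `iℝ ∪ {∞}`. -/
def HasFullColumnRank (G : LinSys σ μ κ) : Prop :=
  (∀ ω : ℝ, Function.Injective (G.transfer (Complex.I * ω)).mulVec) ∧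
    Function.Injective G.transferInfty.mulVec

/-- `y` is the response of the system to the input `u` with zero initial condition. -/
def IsZeroStateResponse (G : LinSys σ μ κ) (u : ℝ → μ → ℝ) (y : ℝ → κ → ℝ) : Prop :=
  ∃ x : ℝ → σ → ℝ,
    IsStateTrajectory x (fun t => G.A.mulVec (x t) + G.B.mulVec (u t)) ∧
    x 0 = 0 ∧ ∀ t, 0 ≤ t → y t = G.C.mulVec (x t) + G.D.mulVec (u t)

/-- The system `diag(ψ, ψ)`, acting on a stacked input, with `• = diag(•, •)` for the matrices
`A, B, C, D`. -/
def double (ψ : LinSys σ μ κ) : LinSys (σ ⊕ σ) (μ ⊕ μ) (κ ⊕ κ) where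
  A := Matrix.fromBlocks ψ.A 0 0 ψ.A
  B := Matrix.fromBlocks ψ.B 0 0 ψ.B
  C := Matrix.fromBlocks ψ.C 0 0 ψ.C
  D := Matrix.fromBlocks ψ.D 0 0 ψ.D

end LinSys

/-! ## The dynamic uncertainty -/

/-- `col(1, c)^* P₀ col(1, c) > 0` for the real symmetric matrix `P₀` and `c ∈ ℂ`; the form is
real-valued. -/
def FDIAt (P₀ : Matrix (Fin 2) (Fin 2) ℝ) (c : ℂ) : Prop :=
  0 < (star ![1, c] ⬝ᵥ (P₀.map Complex.ofReal).mulVec ![1, c]).re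

/-- The strict frequency domain inequality `col(1, δ)^* P₀ col(1, δ) ≻ 0` on `iℝ ∪ {∞}`. -/
def SatisfiesFDI {σ : Type*} [Fintype σ] [DecidableEq σ] (P₀ : Matrix (Fin 2) (Fin 2) ℝ)
    (δ : LinSys σ (Fin 1) (Fin 1)) : Prop :=
  (∀ ω : ℝ, FDIAt P₀ (δ.transfer (Complex.I * ω) 0 0)) ∧ FDIAt P₀ (δ.transferInfty 0 0)

/-- The set `Δ_dy(z)` of all responses `w = δ z`, where `δ` is a stable scalar transfer function
(of any degree, given by a minimal realization with Hurwitz state matrix) that satisfies the strict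
frequency domain inequality for `P₀`. -/
def dynUncertainty (P₀ : Matrix (Fin 2) (Fin 2) ℝ) (z : ℝ → Fin 1 → ℝ) : Set (ℝ → Fin 1 → ℝ) :=
  {w | IsSignal w ∧ ∃ (N : ℕ) (δ : LinSys (Fin N) (Fin 1) (Fin 1)),
    δ.IsMinimal ∧ IsHurwitz δ.A ∧ SatisfiesFDI P₀ δ ∧ δ.IsZeroStateResponse z w}

/-! ## The uncertain loop -/

/-- The matrices of the linear system
`ẋ = A x + B w + B_d d`, `z = C x + D w + D_d d`, `e = C_e x + D_e w + D_ed d`;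
the index types are those of `x`, `w`, `z`, `d`, `e`. -/
structure Plant (ν μ κ η ε : Type*) where
  A : Matrix ν ν ℝ
  B : Matrix ν μ ℝ
  Bd : Matrix ν η ℝ
  C : Matrix κ ν ℝ
  D : Matrix κ μ ℝ
  Dd : Matrix κ η ℝ
  Ce : Matrix ε ν ℝ
  De : Matrix ε μ ℝ
  Ded : Matrix ε η ℝ

/-- `(x, w, z, d, e)` is a trajectory of the interconnection of the plant `G` with `w ∈ Δ(z)`. -/
structure IsLoopTrajectory {ν μ κ η ε : Type*} [Fintype ν] [Fintype μ] [Fintype η]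
    (G : Plant ν μ κ η ε) (Δ : (ℝ → κ → ℝ) → Set (ℝ → μ → ℝ))
    (x : ℝ → ν → ℝ) (w : ℝ → μ → ℝ) (z : ℝ → κ → ℝ) (d : ℝ → η → ℝ) (e : ℝ → ε → ℝ) :
    Prop where
  signal_w : IsSignal w
  signal_z : IsSignal z
  signal_d : IsSignal d
  signal_e : IsSignal e
  state_eq : IsStateTrajectory x
    (fun t => G.A.mulVec (x t) + G.B.mulVec (w t) + G.Bd.mulVec (d t))
  z_eq : ∀ t, 0 ≤ t → z t = G.C.mulVec (x t) + G.D.mulVec (w t) + G.Dd.mulVec (d t)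
  e_eq : ∀ t, 0 ≤ t → e t = G.Ce.mulVec (x t) + G.De.mulVec (w t) + G.Ded.mulVec (d t)
  w_mem : w ∈ Δ z

/-- The quadratic form `vᵀ P v`. -/
def quadForm {ι : Type*} [Fintype ι] (P : Matrix ι ι ℝ) (v : ι → ℝ) : ℝ := v ⬝ᵥ P.mulVec v

/-! ## Linear matrix inequalities -/

/-- The Kronecker product `P₀ ⊗ M` of a `2 × 2` matrix with `M`, as a `2 × 2` block matrix. -/
def kron {ι : Type*} (P₀ : Matrix (Fin 2) (Fin 2) ℝ) (M : Matrix ι ι ℝ) :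
    Matrix (ι ⊕ ι) (ι ⊕ ι) ℝ :=
  (Matrix.kronecker P₀ M).submatrix (Sum.elim (Prod.mk 0) (Prod.mk 1))
    (Sum.elim (Prod.mk 0) (Prod.mk 1))

theorem kron_eq_fromBlocks {ι : Type*} (P₀ : Matrix (Fin 2) (Fin 2) ℝ) (M : Matrix ι ι ℝ) :
    kron P₀ M = Matrix.fromBlocks (P₀ 0 0 • M) (P₀ 0 1 • M) (P₀ 1 0 • M) (P₀ 1 1 • M) := by
  ext (i | i) (j | j) <;> simp [kron, Matrix.kronecker, Matrix.kroneckerMap]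

/-- The coupling condition `[X₁ + Z, X₁₂; X₁₂ᵀ, X₂] ≻ 0`. -/
def CouplingPos {ξ ν : Type*} (X : Matrix (ξ ⊕ ν) (ξ ⊕ ν) ℝ) (Z : Matrix ξ ξ ℝ) : Prop :=
  (Matrix.fromBlocks (X.toBlocks₁₁ + Z) X.toBlocks₁₂ X.toBlocks₁₂.transpose X.toBlocks₂₂).PosDef

/-- The Schur complement `E(X, Z) = X₂ - X₁₂ᵀ (X₁ + Z)⁻¹ X₁₂`. -/
def schurE {ξ ν : Type*} [Fintype ξ] [DecidableEq ξ] (X : Matrix (ξ ⊕ ν) (ξ ⊕ ν) ℝ)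
    (Z : Matrix ξ ξ ℝ) : Matrix ν ν ℝ :=
  X.toBlocks₂₂ - X.toBlocks₁₂.transpose * (X.toBlocks₁₁ + Z)⁻¹ * X.toBlocks₁₂

section LMI

variable {ξ p ν μ κ η ε : Type*} [Fintype ξ] [DecidableEq ξ] [Fintype p] [Fintype ν]
  [DecidableEq ν] [Fintype μ] [Fintype κ] [Fintype η] [DecidableEq η] [Fintype ε]

/-- `[A_Ψ, B_Ψ₁ C, B_Ψ₁ D + B_Ψ₂, B_Ψ₁ D_d; 0, A, B, B_d; I, 0, 0, 0; 0, I, 0, 0]`, with columns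
for `(ξ, x, w, d)`; the inputs of the filter `Ψ` are ordered as `(z, w)`. -/
def outerState (Ψ : LinSys ξ (κ ⊕ μ) p) (G : Plant ν μ κ η ε) :
    Matrix ((ξ ⊕ ν) ⊕ (ξ ⊕ ν)) ((ξ ⊕ ν) ⊕ (μ ⊕ η)) ℝ :=
  Matrix.fromBlocks
    (Matrix.fromBlocks Ψ.A (Ψ.B.toCols₁ * G.C) 0 G.A)
    (Matrix.fromBlocks (Ψ.B.toCols₁ * G.D + Ψ.B.toCols₂) (Ψ.B.toCols₁ * G.Dd) G.B G.Bd)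
    1 0

/-- `[C_Ψ, D_Ψ₁ C, D_Ψ₁ D + D_Ψ₂, D_Ψ₁ D_d]`. -/
def outerFilter (Ψ : LinSys ξ (κ ⊕ μ) p) (G : Plant ν μ κ η ε) :
    Matrix p ((ξ ⊕ ν) ⊕ (μ ⊕ η)) ℝ :=
  Matrix.fromCols
    (Matrix.fromCols Ψ.C (Ψ.D.toCols₁ * G.C))
    (Matrix.fromCols (Ψ.D.toCols₁ * G.D + Ψ.D.toCols₂) (Ψ.D.toCols₁ * G.Dd))

/-- `[0, C_e, D_e, D_ed; 0, 0, 0, I]`. -/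
def outerPerf (ξ : Type*) (G : Plant ν μ κ η ε) : Matrix (ε ⊕ η) ((ξ ⊕ ν) ⊕ (μ ⊕ η)) ℝ :=
  Matrix.fromBlocks
    (Matrix.fromCols 0 G.Ce) (Matrix.fromCols G.De G.Ded)
    0 (Matrix.fromCols 0 1)

/-- The robust performance LMI: the sum of the three congruence terms is negative definite. -/
def PerformanceLMI (Ψ : LinSys ξ (κ ⊕ μ) p) (G : Plant ν μ κ η ε)
    (Pp : Matrix (ε ⊕ η) (ε ⊕ η) ℝ) (X : Matrix (ξ ⊕ ν) (ξ ⊕ ν) ℝ) (P : Matrix p p ℝ) : Prop :=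
  (-((outerState Ψ G).transpose * Matrix.fromBlocks 0 X X 0 * outerState Ψ G
    + (outerFilter Ψ G).transpose * P * outerFilter Ψ G
    + (outerPerf ξ G).transpose * Pp * outerPerf ξ G)).PosDef

/-- `[A, B; I, 0]`. -/
def outerCert (ψ : LinSys ξ μ p) : Matrix (ξ ⊕ ξ) (ξ ⊕ μ) ℝ :=
  Matrix.fromBlocks ψ.A ψ.B 1 0

/-- `[A, B; I, 0]ᵀ [0, K; K, 0] [A, B; I, 0] ≺ [C, D]ᵀ M [C, D]` for the system `ψ`. -/
def CertificateLMI (ψ : LinSys ξ μ p) (K : Matrix ξ ξ ℝ) (M : Matrix p p ℝ) : Prop :=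
  ((Matrix.fromCols ψ.C ψ.D).transpose * M * Matrix.fromCols ψ.C ψ.D
    - (outerCert ψ).transpose * Matrix.fromBlocks 0 K K 0 * outerCert ψ).PosDef

/-- The set of all `(X, K, M)`, symmetric, such that `P = P₀ ⊗ M` and `Z = P₀ ⊗ K` satisfy the
coupling condition, the performance LMI for `Ψ = diag(ψ, ψ)`, and the certificate LMI. -/
def feasibleSet (P₀ : Matrix (Fin 2) (Fin 2) ℝ) (ψ : LinSys ξ (Fin 1) p)
    (G : Plant ν (Fin 1) (Fin 1) η ε) (Pp : Matrix (ε ⊕ η) (ε ⊕ η) ℝ) :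
    Set (Matrix ((ξ ⊕ ξ) ⊕ ν) ((ξ ⊕ ξ) ⊕ ν) ℝ × Matrix ξ ξ ℝ × Matrix p p ℝ) :=
  {Y | Y.1.IsSymm ∧ Y.2.1.IsSymm ∧ Y.2.2.IsSymm ∧
    CouplingPos Y.1 (kron P₀ Y.2.1) ∧
    PerformanceLMI ψ.double G Pp Y.1 (kron P₀ Y.2.2) ∧
    CertificateLMI ψ Y.2.1 Y.2.2}

end LMI

end

end RobustIQC

/-!
Since `N := [C_ψ, D_ψ]ᵀ M [C_ψ, D_ψ] - [A_ψ, B_ψ; I, 0]ᵀ [0, K; K, 0] [A_ψ, B_ψ; I, 0]` is positive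
definite by the certificate LMI, `z` and `w` are filtered at rest with `(A_ψ, B_ψ)`; let `ξ_z`,
`ξ_w` be the filter states and `ζ_z = (ξ_z, z)`, `ζ_w = (ξ_w, w)`. Along a trajectory the form of
`P₀ ⊗ M` in the filter output is the derivative of the form of `Z = P₀ ⊗ K` in `(ξ_z, ξ_w)` plus
the form `Φ` of `P₀ ⊗ N` in `(ζ_z, ζ_w)` (`certificate_bilin`). By the performance LMI, the form of
`X + diag(Z, 0)` in `(ξ_z, ξ_w, x)` therefore has a derivative of at most `-Φ` minus the performance
form. Integrating over `[0, T]` gives the dissipation inequality, provided that `∫₀ᵀ Φ ≥ 0`. The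
form at time `T` is bounded from below by the Schur complement `E(X, Z)` through a completion of
squares, and at time `0` it is `x(0)ᵀ X₂ x(0)` (`robust_performance`).

The inequality `∫₀ᵀ Φ ≥ 0` (`exists_filterStates_integral_nonneg`) rests on two facts.

* The uncertainty `δ` is a scalar system and commutes with the filter. With `N = Rᵀ R`, each
  component of `R ζ_w` is the response of `δ` at rest to the same component of `R ζ_z`. In state
  space this is a Sylvester identity for the cascade of the two systems (`sylvester_of_cascade`),
  which follows from uniqueness of solutions of linear differential equations. This reduces the
  claim to `∫₀ᵀ (q v² + 2 s v w + r w²) ≥ 0` for scalar `v` and `w = δ v`.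
* This scalar inequality holds for every `T` (`SatisfiesFDI.integral_nonneg`). The input is cut off
  at `T`; the state then decays exponentially because the state matrix is Hurwitz
  (`IsHurwitz.expDecay_exp`), so input and output lie in `L¹ ∩ L²` and the frequency domain
  inequality gives the integral inequality on `[0, ∞)` by Plancherel's theorem
  (`integral_norm_sq_fourier`). The part of the integral after `T` is `∫ r w² ≤ 0`.

Convexity of the feasible set holds because, for fixed `P₀`, each of the three conditions asks an
affine function of `(X, K, M)` to be positive definite.
-/

namespace RobustIQC

noncomputable section

open MeasureTheory

/-! ### Plancherel's theorem for `L¹ ∩ L²` -/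

section Plancherel

open FourierTransform SchwartzMap
open scoped ContDiff

/-- On `L¹ ∩ L²` the `L²`-Fourier transform is given by the Fourier integral: both have the same
pairing with every test function. -/
theorem toLp_fourier_ae_eq {f : ℝ → ℂ} (h1 : Integrable f) (h2 : MemLp f 2) :
    (𝓕 (h2.toLp f) : Lp ℂ 2 (volume : Measure ℝ)) =ᵐ[volume] 𝓕 f := by
  refine ae_eq_of_integral_contDiff_smul_eq ?_ ?_ ?_
  · exact (Lp.memLp _).locallyIntegrable (by norm_num)
  · exact (VectorFourier.fourierIntegral_continuous Real.continuous_fourierChar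
      continuous_inner h1).locallyIntegrable
  · intro g hg hgc
    have hg₁ : HasCompactSupport (Complex.ofRealCLM ∘ g) := hgc.comp_left rfl
    have hg₂ : ContDiff ℝ ∞ (Complex.ofRealCLM ∘ g) := by fun_prop
    let φ : 𝓢(ℝ, ℂ) := hg₁.toSchwartzMap hg₂
    have hφ (x) : φ x = g x := rfl
    have e1 := DFunLike.congr_fun (Lp.fourier_toTemperedDistribution_eq (h2.toLp f)) φ
    rw [TemperedDistribution.fourier_apply, Lp.toTemperedDistribution_apply,
      Lp.toTemperedDistribution_apply] at e1
    have e2 : ∫ x, (𝓕 φ) x • (h2.toLp f) x = ∫ x, (𝓕 (φ : ℝ → ℂ)) x • f x := by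
      refine integral_congr_ae ?_
      filter_upwards [h2.coeFn_toLp] with x hx
      rw [hx, SchwartzMap.fourier_coe]
    -- self-adjointness of the Fourier integral, which only needs `f ∈ L¹`
    have e3 : ∫ x, (𝓕 (φ : ℝ → ℂ)) x • f x = ∫ x, φ x • 𝓕 f x := by
      simpa using! VectorFourier.integral_fourierIntegral_smul_eq_flip (L := innerₗ ℝ)
        Real.continuous_fourierChar continuous_inner φ.integrable h1
    have e4 := e1.symm.trans (e2.trans e3)
    simpa only [hφ, Complex.coe_smul] using e4

theorem memLp_two_fourier {f : ℝ → ℂ} (h1 : Integrable f) (h2 : MemLp f 2) :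
    MemLp (𝓕 f) 2 :=
  (memLp_congr_ae (toLp_fourier_ae_eq h1 h2)).1 (Lp.memLp _)

/-- **Plancherel's theorem** for functions in `L¹ ∩ L²`. -/
theorem integral_norm_sq_fourier {f : ℝ → ℂ} (h1 : Integrable f) (h2 : MemLp f 2) :
    ∫ ξ, ‖𝓕 f ξ‖ ^ 2 = ∫ t, ‖f t‖ ^ 2 := by
  have key (g : Lp ℂ 2 (volume : Measure ℝ)) : ‖g‖ ^ 2 = ∫ t, ‖g t‖ ^ 2 := by
    have := L2.inner_def (𝕜 := ℂ) g g
    rw [inner_self_eq_norm_sq_to_K] at this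
    have h : ∀ t, inner ℂ (g t) (g t) = ((‖g t‖ ^ 2 : ℝ) : ℂ) := fun t => by
      rw [inner_self_eq_norm_sq_to_K]; simp
    simp_rw [h, integral_complex_ofReal] at this
    exact Complex.ofReal_injective (by simpa using this)
  have e := key (𝓕 (h2.toLp f))
  rw [Lp.norm_fourier_eq, key] at e
  calc ∫ ξ, ‖𝓕 f ξ‖ ^ 2 = ∫ ξ, ‖(𝓕 (h2.toLp f) : Lp ℂ 2 (volume : Measure ℝ)) ξ‖ ^ 2 := by
        refine integral_congr_ae ?_
        filter_upwards [toLp_fourier_ae_eq h1 h2] with x hx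
        rw [hx]
    _ = ∫ t, ‖h2.toLp f t‖ ^ 2 := e.symm
    _ = ∫ t, ‖f t‖ ^ 2 := by
        refine integral_congr_ae ?_
        filter_upwards [h2.coeFn_toLp] with x hx
        rw [hx]

end Plancherel

/-! ### Exponential decay of the matrix exponential -/

/-- Exponential decay of a vector-valued function on `[0, ∞)`. -/
def ExpDecay {E : Type*} [Norm E] (f : ℝ → E) : Prop :=
  ∃ C a : ℝ, 0 < a ∧ ∀ t, 0 ≤ t → ‖f t‖ ≤ C * Real.exp (-a * t)

theorem ExpDecay.mono {E F : Type*} [Norm E] [Norm F] {f : ℝ → E} {g : ℝ → F}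
    (hf : ExpDecay f) (h : ∀ t, 0 ≤ t → ‖g t‖ ≤ ‖f t‖) : ExpDecay g := by
  obtain ⟨C, a, ha, hC⟩ := hf
  exact ⟨C, a, ha, fun t ht => (h t ht).trans (hC t ht)⟩

theorem ExpDecay.add {E : Type*} [SeminormedAddCommGroup E] {f g : ℝ → E} (hf : ExpDecay f)
    (hg : ExpDecay g) : ExpDecay (fun t => f t + g t) := by
  obtain ⟨C, a, ha, hC⟩ := hf
  obtain ⟨D, b, hb, hD⟩ := hg
  have hC0 : 0 ≤ C := by simpa using (norm_nonneg _).trans (hC 0 le_rfl)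
  have hD0 : 0 ≤ D := by simpa using (norm_nonneg _).trans (hD 0 le_rfl)
  refine ⟨C + D, min a b, lt_min ha hb, fun t ht => ?_⟩
  calc ‖f t + g t‖ ≤ ‖f t‖ + ‖g t‖ := norm_add_le _ _
    _ ≤ C * Real.exp (-a * t) + D * Real.exp (-b * t) := add_le_add (hC t ht) (hD t ht)
    _ ≤ C * Real.exp (-(min a b) * t) + D * Real.exp (-(min a b) * t) := by
      gcongr
      · exact min_le_left _ _
      · exact min_le_right _ _
    _ = _ := by ring

theorem ExpDecay.zero {E : Type*} [SeminormedAddCommGroup E] : ExpDecay (fun _ => (0 : E)) :=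
  ⟨0, 1, one_pos, by simp⟩

theorem ExpDecay.sum {E ι : Type*} [SeminormedAddCommGroup E] (s : Finset ι) {f : ι → ℝ → E}
    (hf : ∀ i ∈ s, ExpDecay (f i)) : ExpDecay (fun t => ∑ i ∈ s, f i t) := by
  classical
  induction s using Finset.induction_on with
  | empty => simpa using ExpDecay.zero
  | insert i s hi ih =>
    simp_rw [Finset.sum_insert hi]
    exact (hf i (Finset.mem_insert_self _ _)).add
      (ih fun j hj => hf j (Finset.mem_insert_of_mem hj))

/-- The polynomial factor is absorbed by half of the decay rate. -/
theorem expDecay_pow_mul_exp (n : ℕ) {b : ℝ} (hb : b < 0) :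
    ExpDecay (fun t : ℝ => t ^ n * Real.exp (b * t)) := by
  have hb' : 0 < -b / 2 := by linarith
  refine ⟨(n.factorial : ℝ) / (-b / 2) ^ n, -b / 2, hb', fun t ht => ?_⟩
  have h := Real.pow_div_factorial_le_exp (x := -b / 2 * t) (by positivity) n
  have hn : (0 : ℝ) < n.factorial := by exact_mod_cast n.factorial_pos
  rw [Real.norm_of_nonneg (by positivity)]
  have e : Real.exp (-(-b / 2) * t) = Real.exp (-b / 2 * t) * Real.exp (b * t) := by
    rw [← Real.exp_add]; ring_nf
  rw [e, ← mul_assoc]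
  refine mul_le_mul_of_nonneg_right ?_ (Real.exp_nonneg _)
  rw [div_mul_eq_mul_div, le_div_iff₀ (by positivity), ← mul_pow, mul_comm t,
    mul_comm (n.factorial : ℝ)]
  exact (div_le_iff₀ hn).1 h

section Exp

variable {E : Type*} [NormedAddCommGroup E] [NormedSpace ℂ E] [FiniteDimensional ℂ E]

/-- On a generalized eigenvector the matrix exponential is `e^{μ t}` times a polynomial. -/
theorem exp_smul_apply_of_pow_eq_zero (A : E →L[ℂ] E) (μ : ℂ) (k : ℕ) (v : E)
    (hv : ((A - algebraMap ℂ (E →L[ℂ] E) μ) ^ k) v = 0) (t : ℝ) :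
    NormedSpace.exp (t • A) v = Complex.exp (t * μ) • ∑ n ∈ Finset.range k,
      ((n.factorial : ℝ)⁻¹ * t ^ n) • ((A - algebraMap ℂ (E →L[ℂ] E) μ) ^ n) v := by
  have := FiniteDimensional.complete ℂ E
  set B := A - algebraMap ℂ (E →L[ℂ] E) μ with hB
  have e1 : t • A = algebraMap ℂ (E →L[ℂ] E) (t * μ) + t • B := by
    rw [hB, map_mul, smul_sub, Algebra.smul_def, Algebra.smul_def]
    have : algebraMap ℂ (E →L[ℂ] E) (t : ℂ) = algebraMap ℝ (E →L[ℂ] E) t := by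
      ext; simp [Algebra.algebraMap_eq_smul_one]
    rw [this]; abel
  let _ : NormedAlgebra ℚ (E →L[ℂ] E) := NormedAlgebra.restrictScalars ℚ ℂ _
  rw [e1, NormedSpace.exp_add_of_commute (Algebra.commutes _ _),
    ← NormedSpace.algebraMap_exp_comm, ← Complex.exp_eq_exp_ℂ]
  rw [Algebra.algebraMap_eq_smul_one, smul_mul_assoc, one_mul]
  change Complex.exp (t * μ) • NormedSpace.exp (t • B) v = _
  congr 1
  have h := (NormedSpace.exp_series_hasSum_exp' (𝕂 := ℝ) (t • B)).mapL
    (ContinuousLinearMap.apply ℂ E v)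
  -- the exponential series of the nilpotent part stops at `k`
  have h2 : ∀ n ∉ Finset.range k,
      (ContinuousLinearMap.apply ℂ E v) ((n.factorial : ℝ)⁻¹ • (t • B) ^ n) = 0 := by
    intro n hn
    obtain ⟨m, rfl⟩ := Nat.exists_eq_add_of_le (not_lt.1 (Finset.mem_range.not.1 hn))
    simp [smul_pow, add_comm k m, pow_add B, hv]
  have h3 := h.unique (hasSum_sum_of_ne_finset_zero h2)
  simpa [smul_pow, smul_smul] using h3

/-- If all eigenvalues have negative real part, then `e^{tA} v` decays exponentially. -/
theorem expDecay_exp_smul (A : E →L[ℂ] E)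
    (hA : ∀ μ ∈ spectrum ℂ (A : Module.End ℂ E), μ.re < 0) (v : E) :
    ExpDecay (fun t : ℝ => NormedSpace.exp (t • A) v) := by
  have hv : v ∈ ⨆ μ, Module.End.maxGenEigenspace (A : Module.End ℂ E) μ := by
    rw [Module.End.iSup_maxGenEigenspace_eq_top]; trivial
  refine Submodule.iSup_induction _ (motive := fun v => ExpDecay (fun t : ℝ =>
    NormedSpace.exp (t • A) v)) hv (fun μ x hx => ?_) (by simpa using ExpDecay.zero)
    (fun x y hx hy => by simpa using hx.add hy)
  · obtain ⟨k, hk⟩ := (Module.End.mem_maxGenEigenspace _ _ _).1 hx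
    rcases eq_or_ne x 0 with rfl | hx0
    · simpa using ExpDecay.zero
    have hμ : μ.re < 0 := by
      refine hA μ (Module.End.hasEigenvalue_iff_mem_spectrum.1 ?_)
      refine Module.End.hasEigenvalue_of_hasGenEigenvalue (k := k) ?_
      intro h
      exact hx0 ((Submodule.mem_bot ℂ).1 (h ▸ (Module.End.mem_genEigenspace_nat.2 hk)))
    have hk' : ((A - algebraMap ℂ (E →L[ℂ] E) μ) ^ k) x = 0 := by
      have : (((A - algebraMap ℂ (E →L[ℂ] E) μ) ^ k : E →L[ℂ] E) : Module.End ℂ E)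
          = ((A : Module.End ℂ E) - μ • 1) ^ k := by
        have := map_pow (ContinuousLinearMap.toLinearMapRingHom (R₁ := ℂ) (M₁ := E))
          (A - algebraMap ℂ (E →L[ℂ] E) μ) k
        refine this.trans ?_
        congr 1
      rw [← this] at hk
      exact hk
    have h (n : ℕ) : ExpDecay (fun t : ℝ => Complex.exp (t * μ) • ((n.factorial : ℝ)⁻¹ * t ^ n) •
        ((A - algebraMap ℂ (E →L[ℂ] E) μ) ^ n) x) := by
      obtain ⟨C, a, ha, hC⟩ := expDecay_pow_mul_exp n hμ
      refine ⟨(n.factorial : ℝ)⁻¹ * ‖((A - algebraMap ℂ (E →L[ℂ] E) μ) ^ n) x‖ * C, a, ha,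
        fun t ht => ?_⟩
      have := hC t ht
      rw [Real.norm_of_nonneg (by positivity)] at this
      rw [norm_smul, norm_smul, Complex.norm_exp, Real.norm_of_nonneg (by positivity)]
      have e : ((t : ℂ) * μ).re = μ.re * t := by simp [mul_comm]
      rw [e]
      calc _ = (n.factorial : ℝ)⁻¹ * ‖((A - algebraMap ℂ (E →L[ℂ] E) μ) ^ n) x‖ *
            (t ^ n * Real.exp (μ.re * t)) := by ring
        _ ≤ (n.factorial : ℝ)⁻¹ * ‖((A - algebraMap ℂ (E →L[ℂ] E) μ) ^ n) x‖ *
            (C * Real.exp (-a * t)) := by gcongr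
        _ = _ := by ring
    refine (ExpDecay.sum (Finset.range k) fun n _ => h n).mono fun t _ => le_of_eq ?_
    rw [exp_smul_apply_of_pow_eq_zero A μ k x hk' t, Finset.smul_sum]

end Exp

/-! ### Piecewise continuous functions and linear differential equations -/

/-- Right-continuous and piecewise continuous functions on `[0, ∞)` with values in any topological
space; for values in `ι → ℝ` these are the signals. -/
structure IsPiecewiseCont {E : Type*} [TopologicalSpace E] (u : ℝ → E) : Prop where
  rightContinuous : ∀ t, 0 ≤ t → ContinuousWithinAt u (Ici t) t
  leftLimit : ∀ t, 0 < t → ∃ a : E, Tendsto u (𝓝[<] t) (𝓝 a)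
  finite_discontinuities : ∀ T, 0 < T → {t | t ∈ Ioo 0 T ∧ ¬ ContinuousAt u t}.Finite

theorem IsSignal.isPiecewiseCont {ι : Type*} {u : ℝ → ι → ℝ} (hu : IsSignal u) :
    IsPiecewiseCont u :=
  ⟨hu.1, hu.2, hu.3⟩

namespace IsPiecewiseCont

section Topological

variable {E F : Type*} [TopologicalSpace E] [TopologicalSpace F] {u : ℝ → E} {v : ℝ → F}

theorem continuous_comp (hu : IsPiecewiseCont u) {φ : E → F} (hφ : Continuous φ) :
    IsPiecewiseCont (fun t => φ (u t)) where
  rightContinuous t ht := hφ.continuousAt.comp_continuousWithinAt (hu.rightContinuous t ht)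
  leftLimit t ht := by
    obtain ⟨a, ha⟩ := hu.leftLimit t ht
    exact ⟨φ a, (hφ.tendsto a).comp ha⟩
  finite_discontinuities T hT :=
    (hu.finite_discontinuities T hT).subset fun t ht =>
      ⟨ht.1, fun h => ht.2 (hφ.continuousAt.comp h)⟩

theorem prodMk (hu : IsPiecewiseCont u) (hv : IsPiecewiseCont v) :
    IsPiecewiseCont (fun t => (u t, v t)) where
  rightContinuous t ht := (hu.rightContinuous t ht).prodMk (hv.rightContinuous t ht)
  leftLimit t ht := by
    obtain ⟨a, ha⟩ := hu.leftLimit t ht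
    obtain ⟨b, hb⟩ := hv.leftLimit t ht
    exact ⟨(a, b), ha.prodMk_nhds hb⟩
  finite_discontinuities T hT := by
    refine ((hu.finite_discontinuities T hT).union (hv.finite_discontinuities T hT)).subset
      fun t ht => ?_
    by_cases h : ContinuousAt u t
    · exact Or.inr ⟨ht.1, fun h' => ht.2 (h.prodMk h')⟩
    · exact Or.inl ⟨ht.1, h⟩

theorem of_continuousOn (hu : ContinuousOn u (Ici 0)) : IsPiecewiseCont u where
  rightContinuous t ht := (hu t ht).mono (Ici_subset_Ici.2 ht)
  leftLimit t ht :=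
    ⟨u t, (hu.continuousAt (Ici_mem_nhds ht)).tendsto.mono_left nhdsWithin_le_nhds⟩
  finite_discontinuities T _ := by
    convert Set.finite_empty
    ext t
    simp only [mem_ofPred_eq, mem_empty_iff_false, iff_false, not_and, not_not]
    exact fun ht => hu.continuousAt (Ici_mem_nhds ht.1)

theorem congr {u' : ℝ → E} (hu : IsPiecewiseCont u) (h : ∀ t, 0 ≤ t → u' t = u t) :
    IsPiecewiseCont u' where
  rightContinuous t ht :=
    (hu.rightContinuous t ht).congr (fun s hs => h s (ht.trans hs)) (h t ht)
  leftLimit t ht := by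
    obtain ⟨a, ha⟩ := hu.leftLimit t ht
    refine ⟨a, ha.congr' ?_⟩
    filter_upwards [nhdsWithin_le_nhds (Ioi_mem_nhds ht)] with s hs
    exact (h s (le_of_lt hs)).symm
  finite_discontinuities T hT := by
    refine (hu.finite_discontinuities T hT).subset fun t ht => ⟨ht.1, fun hc => ht.2 ?_⟩
    refine hc.congr ?_
    filter_upwards [Ioi_mem_nhds ht.1.1] with s hs
    exact (h s (le_of_lt hs)).symm

end Topological

section Normed

variable {E : Type*} [NormedAddCommGroup E] {u : ℝ → E}

/-- Boundedness on compact intervals: near each point the right limit and the left limit bound the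
function. -/
theorem exists_bound (hu : IsPiecewiseCont u) (T : ℝ) :
    ∃ C, ∀ t ∈ Icc 0 T, ‖u t‖ ≤ C := by
  refine isCompact_Icc.induction_on (p := fun s => ∃ C, ∀ t ∈ s, ‖u t‖ ≤ C)
    ⟨0, by simp⟩ (fun s t hst ⟨C, hC⟩ => ⟨C, fun x hx => hC x (hst hx)⟩) ?_ ?_
  · rintro s t ⟨C, hC⟩ ⟨D, hD⟩
    exact ⟨max C D, fun x hx => hx.elim (fun h => (hC x h).trans (le_max_left _ _))
      fun h => (hD x h).trans (le_max_right _ _)⟩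
  · intro t ht
    have hr : ∀ᶠ s in 𝓝[≥] t, ‖u s‖ ≤ ‖u t‖ + 1 :=
      (hu.rightContinuous t ht.1).norm.eventually_le_const (lt_add_one _)
    rcases eq_or_lt_of_le ht.1 with h0 | h0
    · subst h0
      exact ⟨_, nhdsWithin_mono _ Icc_subset_Ici_self hr, _, fun s hs => hs⟩
    · obtain ⟨a, ha⟩ := hu.leftLimit t h0
      have hl : ∀ᶠ s in 𝓝[<] t, ‖u s‖ ≤ ‖a‖ + 1 := ha.norm.eventually_le_const (lt_add_one _)
      refine ⟨{s | ‖u s‖ ≤ max (‖u t‖ + 1) (‖a‖ + 1)}, nhdsWithin_le_nhds ?_, _, fun s hs => hs⟩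
      rw [← nhdsLT_sup_nhdsGE t]
      exact ⟨hl.mono fun s hs => hs.trans (le_max_right _ _),
        hr.mono fun s hs => hs.trans (le_max_left _ _)⟩

/-- Measurability is stated on `(0, T]`, as the values at negative times are arbitrary. -/
theorem aestronglyMeasurable (hu : IsPiecewiseCont u) (T : ℝ) :
    AEStronglyMeasurable u (volume.restrict (Ioc 0 T)) := by
  rcases le_or_gt T 0 with hT | hT
  · simp [Ioc_eq_empty (not_lt.2 hT)]
  set F := {t | t ∈ Ioo 0 T ∧ ¬ ContinuousAt u t}
  have hF : F.Finite := hu.finite_discontinuities T hT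
  have h1 : AEStronglyMeasurable u (volume.restrict (Ioo 0 T \ F)) := by
    refine ContinuousOn.aestronglyMeasurable (fun t ht => ?_)
      (measurableSet_Ioo.diff hF.measurableSet)
    have : ContinuousAt u t := by
      by_contra h
      exact ht.2 ⟨ht.1, h⟩
    exact this.continuousWithinAt
  rw [← Measure.restrict_congr_set (Ioo_ae_eq_Ioc (μ := volume) (a := (0 : ℝ)) (b := T)),
    ← Measure.restrict_congr_set (sdiff_null_ae_eq_self (s := Ioo 0 T) (hF.measure_zero volume))]
  exact h1

theorem integrableOn (hu : IsPiecewiseCont u) (T : ℝ) : IntegrableOn u (Ioc 0 T) := by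
  obtain ⟨C, hC⟩ := hu.exists_bound T
  exact Integrable.of_bound (hu.aestronglyMeasurable T) C
    ((ae_restrict_iff' measurableSet_Ioc).2 (ae_of_all _ fun t ht => hC t (Ioc_subset_Icc_self ht)))

theorem intervalIntegrable (hu : IsPiecewiseCont u) {T : ℝ} (hT : 0 ≤ T) :
    IntervalIntegrable u volume 0 T :=
  (intervalIntegrable_iff_integrableOn_Ioc_of_le hT).2 (hu.integrableOn T)

end Normed

end IsPiecewiseCont

/-- The fundamental theorem of calculus for right-derivatives. -/
theorem integral_eq_sub_of_hasRightDeriv {E : Type*} [NormedAddCommGroup E] [NormedSpace ℝ E]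
    [CompleteSpace E] {x v : ℝ → E} {T : ℝ} (hT : 0 ≤ T)
    (hx : ContinuousOn x (Ici 0)) (hd : ∀ t, 0 ≤ t → HasDerivWithinAt x (v t) (Ici t) t)
    (hv : IsPiecewiseCont v) : ∫ t in (0 : ℝ)..T, v t = x T - x 0 :=
  intervalIntegral.integral_eq_sub_of_hasDeriv_right_of_le hT (hx.mono Icc_subset_Ici_self)
    (fun t ht => (hd t ht.1.le).mono Ioi_subset_Ici_self) (hv.intervalIntegrable hT)

section LinearODE

variable {E : Type*} [NormedAddCommGroup E] [NormedSpace ℝ E]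

theorem linearODE_unique (A : E →L[ℝ] E) {g x y : ℝ → E}
    (hx : ContinuousOn x (Ici 0))
    (hx' : ∀ t, 0 ≤ t → HasDerivWithinAt x (A (x t) + g t) (Ici t) t)
    (hy : ContinuousOn y (Ici 0))
    (hy' : ∀ t, 0 ≤ t → HasDerivWithinAt y (A (y t) + g t) (Ici t) t)
    (h0 : x 0 = y 0) {t : ℝ} (ht : 0 ≤ t) : x t = y t := by
  refine ODE_solution_unique_of_mem_Icc_right (v := fun t e => A e + g t) (K := ‖A‖₊)
    (s := fun _ => univ) (a := 0) (b := t) (fun s _ => ?_)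
    (hx.mono Icc_subset_Ici_self) (fun s hs => hx' s hs.1) (fun _ _ => trivial)
    (hy.mono Icc_subset_Ici_self) (fun s hs => hy' s hs.1) (fun _ _ => trivial) h0
    (right_mem_Icc.2 ht)
  refine LipschitzWith.lipschitzOnWith (LipschitzWith.of_dist_le_mul fun a b => ?_)
  rw [dist_add_right]
  exact A.lipschitz.dist_le_mul a b

variable [CompleteSpace E]

theorem continuous_exp_smul (A : E →L[ℝ] E) : Continuous (fun t : ℝ => NormedSpace.exp (t • A)) :=
  continuous_iff_continuousAt.2 fun t => (hasDerivAt_exp_smul_const A t).continuousAt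

/-- Variation of constants: `x t = e^{tA} ∫₀ᵗ e^{-sA} g s ds`. -/
theorem exists_linearODE (A : E →L[ℝ] E) {g : ℝ → E} (hg : IsPiecewiseCont g) :
    ∃ x : ℝ → E, ContinuousOn x (Ici 0) ∧
      (∀ t, 0 ≤ t → HasDerivWithinAt x (A (x t) + g t) (Ici t) t) ∧ x 0 = 0 := by
  set h : ℝ → E := fun s => NormedSpace.exp ((-s) • A) (g s) with hh
  have hpc : IsPiecewiseCont h :=
    ((IsPiecewiseCont.of_continuousOn ((continuous_exp_smul A).comp continuous_neg).continuousOn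
      (u := fun s => NormedSpace.exp ((-s) • A))).prodMk hg).continuous_comp
      (φ := fun p : (E →L[ℝ] E) × E => p.1 p.2) (by fun_prop)
  have hder (t : ℝ) (ht : 0 ≤ t) :
      HasDerivWithinAt (fun t => ∫ s in (0 : ℝ)..t, h s) (h t) (Ici t) t := by
    refine intervalIntegral.integral_hasDerivWithinAt_right (t := Ioi t)
      (hpc.intervalIntegrable ht)
      ⟨Ioc 0 (t + 1), ?_, hpc.aestronglyMeasurable _⟩
      ((hpc.rightContinuous t ht).mono Ioi_subset_Ici_self)
    exact mem_of_superset (Ioc_mem_nhdsGT (lt_add_one t)) (Ioc_subset_Ioc_left ht)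
  have hcont : ContinuousOn (fun t => ∫ s in (0 : ℝ)..t, h s) (Ici 0) := by
    intro t ht
    have ht1 : (0 : ℝ) ≤ t + 1 := add_nonneg ht zero_le_one
    have := intervalIntegral.continuousOn_primitive_interval' (hpc.intervalIntegrable ht1)
      left_mem_uIcc
    rw [uIcc_of_le ht1] at this
    refine (this t ⟨ht, (lt_add_one t).le⟩).mono_of_mem_nhdsWithin ?_
    exact inter_mem_nhdsWithin _ (Iic_mem_nhds (lt_add_one t))
  refine ⟨fun t => NormedSpace.exp (t • A) (∫ s in (0 : ℝ)..t, h s), ?_, ?_, ?_⟩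
  · exact (continuous_exp_smul A).continuousOn.clm_apply hcont
  · intro t ht
    have := (hasDerivAt_exp_smul_const' A t).hasDerivWithinAt (s := Ici t) |>.clm_apply (hder t ht)
    convert this using 1
    have e : NormedSpace.exp (t • A) (h t) = g t := by
      let _ : NormedAlgebra ℚ (E →L[ℝ] E) := NormedAlgebra.restrictScalars ℚ ℝ _
      have := NormedSpace.exp_add_of_commute (x := t • A) (y := (-t) • A)
        ((Commute.refl A).smul_left t |>.smul_right (-t))
      rw [← add_smul, add_neg_cancel, zero_smul, NormedSpace.exp_zero] at this
      rw [hh]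
      exact (DFunLike.congr_fun this (g t)).symm
    rw [e]
    rfl
  · simp

/-- A solution of `ẋ = A x + g` can be stopped at time `T` and continued as a free motion. Written
with `max` and `min`, this is one formula for all times, whose continuity is immediate; the result
solves the equation whose forcing term is cut off at `T`. -/
theorem hasDerivWithinAt_freeContinuation (A : E →L[ℝ] E) {g x : ℝ → E} {T : ℝ}
    (hx' : ∀ t, 0 ≤ t → HasDerivWithinAt x (A (x t) + g t) (Ici t) t) {t : ℝ} (ht : 0 ≤ t) :
    HasDerivWithinAt (fun t => NormedSpace.exp ((max t T - T) • A) (x (min t T)))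
      (A (NormedSpace.exp ((max t T - T) • A) (x (min t T))) + (Iio T).indicator g t)
      (Ici t) t := by
  rcases lt_or_ge t T with h | h
  · have e : (fun t => NormedSpace.exp ((max t T - T) • A) (x (min t T))) =ᶠ[𝓝[≥] t] x := by
      filter_upwards [nhdsWithin_le_nhds (Iio_mem_nhds h)] with s hs
      rw [max_eq_right (le_of_lt hs), min_eq_left (le_of_lt hs)]
      simp
    rw [indicator_of_mem (mem_Iio.2 h), max_eq_right h.le, min_eq_left h.le]
    simpa using (hx' t ht).congr_of_eventuallyEq_of_mem e self_mem_Ici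
  · rw [indicator_of_notMem (by simpa using h), add_zero, max_eq_left h, min_eq_right h]
    have h1 : HasDerivWithinAt (fun t : ℝ => NormedSpace.exp ((t - T) • A) (x T))
        (A (NormedSpace.exp ((t - T) • A) (x T))) (Ici t) t := by
      have h2 := (hasDerivAt_exp_smul_const' A (t - T)).scomp t ((hasDerivAt_id t).sub_const T)
      have h3 := (h2.clm_apply (hasDerivAt_const t (x T))).hasDerivWithinAt (s := Ici t)
      simpa using! h3
    refine h1.congr (fun s hs => ?_) ?_
    · rw [max_eq_left (h.trans hs), min_eq_right (h.trans hs)]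
    · rw [max_eq_left h, min_eq_right h]

theorem continuousOn_freeContinuation (A : E →L[ℝ] E) {x : ℝ → E} {T : ℝ} (hT : 0 ≤ T)
    (hx : ContinuousOn x (Ici 0)) :
    ContinuousOn (fun t => NormedSpace.exp ((max t T - T) • A) (x (min t T))) (Ici 0) := by
  refine ContinuousOn.clm_apply ?_ ?_
  · exact ((continuous_exp_smul A).comp (by fun_prop)).continuousOn
  · exact hx.comp (by fun_prop) fun t ht => le_min ht hT

end LinearODE

/-! ### The Fourier transform of decaying functions on the half line -/

section Decay

variable {E : Type*} [NormedAddCommGroup E] {u : ℝ → E}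

theorem IsPiecewiseCont.aestronglyMeasurable_Ioi (hu : IsPiecewiseCont u) :
    AEStronglyMeasurable u (volume.restrict (Ioi 0)) := by
  have : Ioi (0 : ℝ) = ⋃ n : ℕ, Ioc (0 : ℝ) n := by
    ext t
    simp only [mem_Ioi, mem_iUnion, mem_Ioc]
    exact ⟨fun h => ⟨⌈t⌉₊, h, Nat.le_ceil t⟩, fun ⟨n, h⟩ => h.1⟩
  rw [this, aestronglyMeasurable_iUnion_iff]
  exact fun n => hu.aestronglyMeasurable n

theorem IsPiecewiseCont.integrableOn_Ioi (hu : IsPiecewiseCont u) (hd : ExpDecay u) :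
    IntegrableOn u (Ioi 0) := by
  obtain ⟨C, a, ha, hC⟩ := hd
  refine Integrable.mono' ((integrableOn_exp_mul_Ioi (neg_lt_zero.2 ha) 0).const_mul C)
    hu.aestronglyMeasurable_Ioi ?_
  exact (ae_restrict_iff' measurableSet_Ioi).2 (ae_of_all _ fun t ht => hC t (le_of_lt ht))

theorem ExpDecay.sq_norm (hd : ExpDecay u) : ExpDecay (fun t => ‖u t‖ ^ 2) := by
  obtain ⟨C, a, ha, hC⟩ := hd
  refine ⟨C ^ 2, 2 * a, by positivity, fun t ht => ?_⟩
  rw [Real.norm_of_nonneg (by positivity),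
    show -(2 * a) * t = (-a * t) + (-a * t) by ring, Real.exp_add]
  calc ‖u t‖ ^ 2 ≤ (C * Real.exp (-a * t)) ^ 2 := by gcongr; exact hC t ht
    _ = _ := by ring

theorem ExpDecay.tendsto_zero (hd : ExpDecay u) : Tendsto u atTop (𝓝 0) := by
  obtain ⟨C, a, ha, hC⟩ := hd
  refine squeeze_zero_norm' (a := fun t => C * Real.exp (-a * t)) ?_ ?_
  · filter_upwards [eventually_ge_atTop 0] with t ht using hC t ht
  · have h1 : Tendsto (fun t : ℝ => -a * t) atTop atBot :=
      tendsto_id.const_mul_atTop_of_neg (neg_lt_zero.2 ha)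
    simpa using (Real.tendsto_exp_atBot.comp h1).const_mul C

theorem ExpDecay.clm_comp {𝕜 F : Type*} [NontriviallyNormedField 𝕜] [NormedSpace 𝕜 E]
    [NormedAddCommGroup F] [NormedSpace 𝕜 F] (hd : ExpDecay u) (L : E →L[𝕜] F) :
    ExpDecay (fun t => L (u t)) := by
  obtain ⟨C, a, ha, hC⟩ := hd
  refine ⟨‖L‖ * C, a, ha, fun t ht => (L.le_opNorm _).trans ?_⟩
  rw [mul_assoc]
  gcongr
  exact hC t ht

/-- Bounded on `[0, T)` and exponentially decaying from `T` on. -/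
theorem ExpDecay.of_shift {T : ℝ} (hT : 0 ≤ T) {C₀ : ℝ} (h₀ : ∀ t ∈ Icc 0 T, ‖u t‖ ≤ C₀)
    {g : ℝ → E} (hg : ExpDecay g) (h : ∀ t, T ≤ t → u t = g (t - T)) : ExpDecay u := by
  obtain ⟨C, a, ha, hC⟩ := hg
  have hC0 : 0 ≤ C := by simpa using (norm_nonneg _).trans (hC 0 le_rfl)
  have hC00 : 0 ≤ C₀ := (norm_nonneg _).trans (h₀ 0 ⟨le_rfl, hT⟩)
  refine ⟨(C₀ + C) * Real.exp (a * T), a, ha, fun t ht => ?_⟩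
  rw [mul_assoc, ← Real.exp_add]
  rcases le_total t T with htT | htT
  · have : 1 ≤ Real.exp (a * T + -a * t) := Real.one_le_exp (by nlinarith)
    calc ‖u t‖ ≤ C₀ := h₀ t ⟨ht, htT⟩
      _ ≤ (C₀ + C) * 1 := by linarith
      _ ≤ _ := by gcongr
  · rw [h t htT]
    refine (hC _ (sub_nonneg.2 htT)).trans ?_
    rw [show -a * (t - T) = a * T + -a * t by ring]
    gcongr
    linarith

end Decay

/-- Cutting a piecewise continuous function off at time `T` keeps it piecewise continuous. -/
theorem IsPiecewiseCont.indicator_Iio {E : Type*} [TopologicalSpace E] [Zero E] {u : ℝ → E}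
    (hu : IsPiecewiseCont u) (T : ℝ) : IsPiecewiseCont ((Iio T).indicator u) where
  rightContinuous t ht := by
    rcases lt_or_ge t T with h | h
    · refine (hu.rightContinuous t ht).congr_of_eventuallyEq ?_ (indicator_of_mem (mem_Iio.2 h) _)
      filter_upwards [nhdsWithin_le_nhds (Iio_mem_nhds h)] with s hs using indicator_of_mem hs _
    · refine ContinuousWithinAt.congr (f := fun _ => (0 : E)) continuousWithinAt_const
        (fun s hs => ?_) ?_
      · exact indicator_of_notMem (show s ∉ Iio T from not_lt.2 (h.trans hs)) _
      · exact indicator_of_notMem (show t ∉ Iio T from not_lt.2 h) _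
  leftLimit t ht := by
    rcases le_or_gt t T with h | h
    · obtain ⟨a, ha⟩ := hu.leftLimit t ht
      refine ⟨a, ha.congr' ?_⟩
      filter_upwards [self_mem_nhdsWithin] with s hs
      exact (indicator_of_mem (mem_Iio.2 (lt_of_lt_of_le hs h)) _).symm
    · refine ⟨0, tendsto_const_nhds.congr' ?_⟩
      filter_upwards [nhdsWithin_le_nhds (Ioi_mem_nhds h)] with s (hs : T < s)
      exact (indicator_of_notMem (show s ∉ Iio T from not_lt.2 (le_of_lt hs)) _).symm
  finite_discontinuities S hS := by
    refine ((hu.finite_discontinuities S hS).union (finite_singleton T)).subset fun t ht => ?_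
    rcases lt_trichotomy t T with h | h | h
    · refine Or.inl ⟨ht.1, fun hc => ht.2 (hc.congr ?_)⟩
      filter_upwards [Iio_mem_nhds h] with s hs using (indicator_of_mem hs _).symm
    · exact Or.inr h
    · refine absurd (continuousAt_const.congr (f := fun _ => (0 : E)) ?_) ht.2
      filter_upwards [Ioi_mem_nhds h] with s (hs : T < s)
      exact (indicator_of_notMem (show s ∉ Iio T from not_lt.2 (le_of_lt hs)) _).symm

section HalfLine

variable {E : Type*} [NormedAddCommGroup E] [NormedSpace ℂ E]

/-- The Fourier transform `∫₀^∞ e^{-iωt} u(t) dt` of a function on the half line. -/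
def halfLineFourier (ω : ℝ) (u : ℝ → E) : E :=
  ∫ t in Ioi (0 : ℝ), Complex.exp (-(Complex.I * ω * t)) • u t

theorem norm_exp_neg_I_mul (ω t : ℝ) : ‖Complex.exp (-(Complex.I * ω * t))‖ = 1 := by
  rw [Complex.norm_exp]; simp

theorem IsPiecewiseCont.exp_smul {u : ℝ → E} (hu : IsPiecewiseCont u) (ω : ℝ) :
    IsPiecewiseCont (fun t => Complex.exp (-(Complex.I * ω * t)) • u t) :=
  ((IsPiecewiseCont.of_continuousOn (u := fun t : ℝ => Complex.exp (-(Complex.I * ω * t)))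
    (by fun_prop)).prodMk hu).continuous_comp (φ := fun p : ℂ × E => p.1 • p.2) (by fun_prop)

theorem ExpDecay.exp_smul {u : ℝ → E} (hu : ExpDecay u) (ω : ℝ) :
    ExpDecay (fun t : ℝ => Complex.exp (-(Complex.I * ω * t)) • u t) :=
  hu.mono fun t _ => by rw [norm_smul, norm_exp_neg_I_mul, one_mul]

theorem halfLineFourier_clm [CompleteSpace E] {F : Type*} [NormedAddCommGroup F]
    [NormedSpace ℂ F] [CompleteSpace F]
    (L : E →L[ℂ] F) {u : ℝ → E} (hu : IsPiecewiseCont u) (hd : ExpDecay u) (ω : ℝ) :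
    halfLineFourier ω (fun t => L (u t)) = L (halfLineFourier ω u) := by
  unfold halfLineFourier
  rw [← L.integral_comp_comm ((hu.exp_smul ω).integrableOn_Ioi (hd.exp_smul ω))]
  simp

theorem halfLineFourier_add {u v : ℝ → E} (hu : IsPiecewiseCont u) (hud : ExpDecay u)
    (hv : IsPiecewiseCont v) (hvd : ExpDecay v) (ω : ℝ) :
    halfLineFourier ω (fun t => u t + v t) = halfLineFourier ω u + halfLineFourier ω v := by
  unfold halfLineFourier
  rw [← integral_add ((hu.exp_smul ω).integrableOn_Ioi (hud.exp_smul ω))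
    ((hv.exp_smul ω).integrableOn_Ioi (hvd.exp_smul ω))]
  simp

/-- Integration by parts: differentiation becomes multiplication by `iω`. -/
theorem halfLineFourier_rightDeriv [CompleteSpace E] {x v : ℝ → E} (hx : ContinuousOn x (Ici 0))
    (hx' : ∀ t, 0 ≤ t → HasDerivWithinAt x (v t) (Ici t) t) (hx0 : x 0 = 0) (hxd : ExpDecay x)
    (hv : IsPiecewiseCont v) (hvd : ExpDecay v) (ω : ℝ) :
    halfLineFourier ω v = (Complex.I * ω) • halfLineFourier ω x := by
  have hxp := IsPiecewiseCont.of_continuousOn hx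
  have hd (t : ℝ) (ht : 0 ≤ t) : HasDerivWithinAt
      (fun t : ℝ => Complex.exp (-(Complex.I * ω * t)) • x t)
      (Complex.exp (-(Complex.I * ω * t)) • v t
        + (-(Complex.I * ω)) • Complex.exp (-(Complex.I * ω * t)) • x t) (Ici t) t := by
    have h1 : HasDerivAt (fun t : ℝ => Complex.exp (-(Complex.I * ω * t)))
        (Complex.exp (-(Complex.I * ω * t)) * (-(Complex.I * ω))) t := by
      have h2 : HasDerivAt (fun t : ℝ => -(Complex.I * ω * (t : ℂ))) (-(Complex.I * ω)) t := by
        simpa using! ((Complex.ofRealCLM.hasDerivAt (x := t)).const_mul (Complex.I * ω)).neg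
      exact h2.cexp
    have h3 := h1.hasDerivWithinAt (s := Ici t) |>.smul (hx' t ht)
    refine h3.congr_deriv ?_
    rw [smul_smul, mul_comm (Complex.exp _)]
  have hxi := (hxp.exp_smul ω).integrableOn_Ioi (hxd.exp_smul ω)
  have hvi := (hv.exp_smul ω).integrableOn_Ioi (hvd.exp_smul ω)
  have hpc : IsPiecewiseCont (fun t : ℝ => Complex.exp (-(Complex.I * ω * t)) • v t
        + (-(Complex.I * ω)) • Complex.exp (-(Complex.I * ω * t)) • x t) :=
    ((hv.exp_smul ω).prodMk (hxp.exp_smul ω)).continuous_comp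
      (φ := fun p : E × E => p.1 + (-(Complex.I * ω)) • p.2) (by fun_prop)
  have hint := hvi.add (hxi.smul (-(Complex.I * ω)))
  -- the boundary terms vanish: `x 0 = 0`, and `x` tends to zero at infinity
  have hlim := intervalIntegral_tendsto_integral_Ioi 0 hint tendsto_id
  have hlim2 : Tendsto (fun T : ℝ => ∫ t in (0 : ℝ)..T, (Complex.exp (-(Complex.I * ω * t)) • v t
        + (-(Complex.I * ω)) • Complex.exp (-(Complex.I * ω * t)) • x t)) atTop (𝓝 0) := by
    refine (hxd.exp_smul ω).tendsto_zero.congr' ?_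
    filter_upwards [eventually_ge_atTop 0] with T hT
    rw [integral_eq_sub_of_hasRightDeriv hT ((by fun_prop : ContinuousOn
      (fun t : ℝ => Complex.exp (-(Complex.I * ω * t))) (Ici 0)).fun_smul hx) hd hpc, hx0,
      smul_zero, sub_zero]
  have h := tendsto_nhds_unique hlim hlim2
  have h' : halfLineFourier ω v + (-(Complex.I * ω)) • halfLineFourier ω x = 0 := by
    rw [← h]
    unfold halfLineFourier
    rw [← integral_smul]
    exact (integral_add hvi (hxi.smul (-(Complex.I * ω)))).symm
  rw [neg_smul, ← sub_eq_add_neg] at h'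
  exact sub_eq_zero.1 h'

end HalfLine

section Frequency

open FourierTransform

/-- Mathlib's Fourier transform is normalized with `e^{-2πitξ}`, hence `ω = 2πξ`. -/
theorem fourier_indicator_Ioi (u : ℝ → ℂ) (ξ : ℝ) :
    𝓕 ((Ioi (0 : ℝ)).indicator u) ξ = halfLineFourier (2 * Real.pi * ξ) u := by
  rw [Real.fourier_real_eq_integral_exp_smul, halfLineFourier,
    ← integral_indicator measurableSet_Ioi]
  congr 1
  ext t
  rw [← indicator_const_smul_apply]
  by_cases ht : t ∈ Ioi (0 : ℝ)
  · rw [indicator_of_mem ht, indicator_of_mem ht]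
    congr 2
    push_cast
    ring
  · rw [indicator_of_notMem ht, indicator_of_notMem ht]

theorem integrable_indicator_of_expDecay {u : ℝ → ℂ} (hu : IsPiecewiseCont u) (hd : ExpDecay u) :
    Integrable ((Ioi (0 : ℝ)).indicator u) :=
  (integrable_indicator_iff measurableSet_Ioi).2 (hu.integrableOn_Ioi hd)

theorem memLp_two_indicator_of_expDecay {u : ℝ → ℂ} (hu : IsPiecewiseCont u) (hd : ExpDecay u) :
    MemLp ((Ioi (0 : ℝ)).indicator u) 2 := by
  rw [memLp_indicator_iff_restrict measurableSet_Ioi,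
    memLp_two_iff_integrable_sq_norm hu.aestronglyMeasurable_Ioi]
  exact (hu.continuous_comp (φ := fun z : ℂ => ‖z‖ ^ 2) (by fun_prop)).integrableOn_Ioi hd.sq_norm

theorem integrable_sq_halfLineFourier {u : ℝ → ℂ} (hu : IsPiecewiseCont u) (hd : ExpDecay u) :
    Integrable (fun ξ : ℝ => ‖halfLineFourier (2 * Real.pi * ξ) u‖ ^ 2) := by
  have h := memLp_two_fourier (integrable_indicator_of_expDecay hu hd)
    (memLp_two_indicator_of_expDecay hu hd)
  have := (memLp_two_iff_integrable_sq_norm h.1).1 h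
  simpa only [fourier_indicator_Ioi] using this

theorem integral_sq_halfLineFourier {u : ℝ → ℂ} (hu : IsPiecewiseCont u) (hd : ExpDecay u) :
    ∫ ξ : ℝ, ‖halfLineFourier (2 * Real.pi * ξ) u‖ ^ 2 = ∫ t in Ioi (0 : ℝ), ‖u t‖ ^ 2 := by
  have h := integral_norm_sq_fourier (integrable_indicator_of_expDecay hu hd)
    (memLp_two_indicator_of_expDecay hu hd)
  simp only [fourier_indicator_Ioi] at h
  rw [h, ← integral_indicator measurableSet_Ioi]
  congr 1
  ext t
  by_cases ht : t ∈ Ioi (0 : ℝ)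
  · rw [indicator_of_mem ht, indicator_of_mem ht]
  · rw [indicator_of_notMem ht, indicator_of_notMem ht]; simp

theorem integral_const_mul_add₃ {α : Type*} [MeasurableSpace α] {μ : Measure α} {f g h : α → ℝ}
    (hf : Integrable f μ) (hg : Integrable g μ) (hh : Integrable h μ) (a b c : ℝ) :
    ∫ t, (a * f t + b * g t + c * h t) ∂μ =
      a * ∫ t, f t ∂μ + b * ∫ t, g t ∂μ + c * ∫ t, h t ∂μ := by
  rw [integral_add (f := fun t => a * f t + b * g t)
    ((hf.const_mul a).add (hg.const_mul b)) (hh.const_mul c),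
    integral_add (hf.const_mul a) (hg.const_mul b), integral_const_mul, integral_const_mul,
    integral_const_mul]

/-- A frequency-wise inequality `ŵ = δ f̂`, `q + 2 s Re δ + r |δ|² ≥ 0` for the transforms gives
the corresponding integral quadratic constraint on the half line. -/
theorem integral_quadratic_nonneg_of_frequency {f w : ℝ → ℝ} {q s r : ℝ}
    (hf : IsPiecewiseCont f) (hfd : ExpDecay f) (hw : IsPiecewiseCont w) (hwd : ExpDecay w)
    {δ : ℝ → ℂ} (hδ : ∀ ω, 0 ≤ q + 2 * s * (δ ω).re + r * ‖δ ω‖ ^ 2)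
    (hfw : ∀ ω, halfLineFourier ω (fun t => (w t : ℂ)) =
      δ ω * halfLineFourier ω (fun t => (f t : ℂ))) :
    0 ≤ ∫ t in Ioi (0 : ℝ), (q * f t ^ 2 + 2 * s * (f t * w t) + r * w t ^ 2) := by
  have cast {u : ℝ → ℝ} (hu : IsPiecewiseCont u) : IsPiecewiseCont (fun t => (u t : ℂ)) :=
    hu.continuous_comp Complex.continuous_ofReal
  have castd {u : ℝ → ℝ} (hu : ExpDecay u) : ExpDecay (fun t => (u t : ℂ)) :=
    hu.mono fun t _ => by simp
  have sqi {u : ℝ → ℝ} (hu : IsPiecewiseCont u) (hd : ExpDecay u) :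
      IntegrableOn (fun t => u t ^ 2) (Ioi 0) :=
    (hu.continuous_comp (φ := fun z : ℝ => z ^ 2) (by fun_prop)).integrableOn_Ioi
      (hd.sq_norm.mono fun t _ => by simp)
  have pl {u : ℝ → ℝ} (hu : IsPiecewiseCont u) (hd : ExpDecay u) :
      ∫ t in Ioi (0 : ℝ), u t ^ 2 =
        ∫ ξ : ℝ, ‖halfLineFourier (2 * Real.pi * ξ) (fun t => (u t : ℂ))‖ ^ 2 := by
    rw [integral_sq_halfLineFourier (cast hu) (castd hd)]
    simp
  have hs : IsPiecewiseCont (fun t => f t + w t) :=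
    (hf.prodMk hw).continuous_comp (φ := fun p : ℝ × ℝ => p.1 + p.2) (by fun_prop)
  have hsd := hfd.add hwd
  -- polarization: `2 f w = (f + w)² - f² - w²`
  have e : ∀ t, q * f t ^ 2 + 2 * s * (f t * w t) + r * w t ^ 2 =
      (q - s) * f t ^ 2 + (r - s) * w t ^ 2 + s * (f t + w t) ^ 2 := fun t => by ring
  simp_rw [e]
  rw [integral_const_mul_add₃ (sqi hf hfd) (sqi hw hwd) (sqi hs hsd), pl hf hfd, pl hw hwd,
    pl hs hsd, ← integral_const_mul_add₃ (integrable_sq_halfLineFourier (cast hf) (castd hfd))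
      (integrable_sq_halfLineFourier (cast hw) (castd hwd))
      (integrable_sq_halfLineFourier (cast hs) (castd hsd))]
  -- the integrand is `(q + 2 s Re δ + r |δ|²) |f̂|²`
  refine integral_nonneg fun ξ => ?_
  set ω := 2 * Real.pi * ξ
  have hsum : halfLineFourier ω (fun t => ((f t + w t : ℝ) : ℂ)) =
      (1 + δ ω) * halfLineFourier ω (fun t => (f t : ℂ)) := by
    simp_rw [Complex.ofReal_add]
    rw [halfLineFourier_add (cast hf) (castd hfd) (cast hw) (castd hwd), hfw]
    ring
  have h1 : ‖1 + δ ω‖ ^ 2 = 1 + 2 * (δ ω).re + ‖δ ω‖ ^ 2 := by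
    rw [Complex.sq_norm, Complex.sq_norm, Complex.normSq_apply, Complex.normSq_apply]
    simp
    ring
  simp only [Pi.zero_apply]
  rw [hsum, hfw, norm_mul, norm_mul, mul_pow, mul_pow, h1]
  calc 0 ≤ (q + 2 * s * (δ ω).re + r * ‖δ ω‖ ^ 2) *
        ‖halfLineFourier ω (fun t => (f t : ℂ))‖ ^ 2 := mul_nonneg (hδ ω) (by positivity)
    _ = _ := by ring

end Frequency

/-! ### Stable scalar systems with a frequency domain inequality -/

/-- The continuous linear map `x ↦ A x`. -/
def mulVecCLM {𝕜 m n : Type*} [RCLike 𝕜] [Fintype n] [Finite m] (A : Matrix m n 𝕜) :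
    (n → 𝕜) →L[𝕜] (m → 𝕜) :=
  LinearMap.toContinuousLinearMap A.mulVecLin

@[simp]
theorem mulVecCLM_apply {𝕜 m n : Type*} [RCLike 𝕜] [Fintype n] [Finite m] (A : Matrix m n 𝕜)
    (x : n → 𝕜) : mulVecCLM A x = A.mulVec x := rfl

theorem continuous_mulVec {m n : Type*} [Fintype n] [Finite m] (A : Matrix m n ℝ) :
    Continuous A.mulVec := (mulVecCLM A).continuous

/-- The inclusion of real into complex vectors. -/
def complexify (ι : Type*) : (ι → ℝ) →L[ℝ] (ι → ℂ) :=
  ContinuousLinearMap.pi fun i => Complex.ofRealCLM.comp (ContinuousLinearMap.proj i)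

@[simp]
theorem complexify_apply {ι : Type*} (x : ι → ℝ) (i : ι) : complexify ι x i = x i := rfl

theorem complexify_mulVec {m n : Type*} [Fintype n] (A : Matrix m n ℝ) (x : n → ℝ) :
    complexify m (A.mulVec x) = (A.map Complex.ofReal).mulVec (complexify n x) := by
  ext i
  simp [Matrix.mulVec, dotProduct]

theorem norm_complexify {ι : Type*} [Fintype ι] (x : ι → ℝ) : ‖complexify ι x‖ = ‖x‖ := by
  simp [Pi.norm_def]

section Hurwitz

variable {σ : Type*} [Fintype σ] [DecidableEq σ] {A : Matrix σ σ ℝ}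

/-- The decay of the real matrix exponential is inherited from its complexification, since both
motions solve the same differential equation. -/
theorem IsHurwitz.expDecay_exp (hA : IsHurwitz A) (v : σ → ℝ) :
    ExpDecay (fun t : ℝ => NormedSpace.exp (t • mulVecCLM A) v) := by
  set Ac : (σ → ℂ) →L[ℂ] (σ → ℂ) := mulVecCLM (A.map Complex.ofReal)
  have hsp : ∀ μ ∈ spectrum ℂ (Ac : Module.End ℂ (σ → ℂ)), μ.re < 0 := by
    intro μ hμ
    refine hA μ ?_
    rw [← Matrix.spectrum_toLin']
    exact hμ
  refine (expDecay_exp_smul Ac hsp (complexify σ v)).mono fun t ht => le_of_eq ?_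
  rw [← norm_complexify]
  congr 1
  have hx (t : ℝ) : HasDerivAt (fun t : ℝ => NormedSpace.exp (t • mulVecCLM A) v)
      (mulVecCLM A (NormedSpace.exp (t • mulVecCLM A) v)) t := by
    simpa using! (hasDerivAt_exp_smul_const' (mulVecCLM A) t).clm_apply (hasDerivAt_const t v)
  have hy (t : ℝ) : HasDerivAt (fun t : ℝ => NormedSpace.exp (t • Ac) (complexify σ v))
      (Ac (NormedSpace.exp (t • Ac) (complexify σ v))) t := by
    have h := ((ContinuousLinearMap.apply ℂ (σ → ℂ) (complexify σ v)).restrictScalars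
      ℝ).hasFDerivAt.comp_hasDerivAt t (hasDerivAt_exp_smul_const' (𝕂 := ℝ) Ac t)
    exact h
  have hx' (t : ℝ) := (complexify σ).hasFDerivAt.comp_hasDerivAt t (hx t)
  refine linearODE_unique (Ac.restrictScalars ℝ) (g := fun _ => 0)
    (x := fun t : ℝ => complexify σ (NormedSpace.exp (t • mulVecCLM A) v))
    (y := fun t : ℝ => NormedSpace.exp (t • Ac) (complexify σ v)) ?_ ?_ ?_ ?_
    ?_ ht
  · exact fun t _ => (hx' t).continuousAt.continuousWithinAt
  · intro t _
    rw [add_zero]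
    refine (hx' t).hasDerivWithinAt.congr_deriv ?_
    exact complexify_mulVec A _
  · exact fun t _ => (hy t).continuousAt.continuousWithinAt
  · intro t _
    rw [add_zero]
    exact (hy t).hasDerivWithinAt
  · have hz : (0 : ℝ) • Ac = 0 := zero_smul ℝ Ac
    simp only [zero_smul, hz, NormedSpace.exp_zero]
    rfl

theorem IsHurwitz.isUnit_resolvent (hA : IsHurwitz A) (ω : ℝ) :
    IsUnit ((Complex.I * ω) • (1 : Matrix σ σ ℂ) - A.map Complex.ofReal) := by
  by_contra h
  have := hA (Complex.I * ω) (by rwa [spectrum.mem_iff, Algebra.algebraMap_eq_smul_one])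
  simp at this

/-- The frequency response of a stable system started at rest. -/
theorem halfLineFourier_response (δ : LinSys σ (Fin 1) (Fin 1)) (hA : IsHurwitz δ.A)
    {p : ℝ → σ → ℝ} {f : ℝ → ℝ} (hp : ContinuousOn p (Ici 0))
    (hp' : ∀ t, 0 ≤ t →
      HasDerivWithinAt p (δ.A.mulVec (p t) + δ.B.mulVec (fun _ => f t)) (Ici t) t)
    (hp0 : p 0 = 0) (hpd : ExpDecay p) (hf : IsPiecewiseCont f) (hfd : ExpDecay f) (ω : ℝ) :
    halfLineFourier ω (fun t => (((δ.C.mulVec (p t) + δ.D.mulVec (fun _ => f t)) 0 : ℝ) : ℂ)) =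
      δ.transfer (Complex.I * ω) 0 0 * halfLineFourier ω (fun t => (f t : ℂ)) := by
  set Ac := δ.A.map Complex.ofReal with hAc
  set b := (δ.B.map Complex.ofReal).mulVec (fun _ => 1) with hb
  set P : ℝ → σ → ℂ := fun t => complexify σ (p t) with hP
  set F : ℝ → ℂ := fun t => (f t : ℂ) with hF
  have hFp : IsPiecewiseCont F := hf.continuous_comp Complex.continuous_ofReal
  have hFd : ExpDecay F := hfd.mono fun t _ => by simp [hF]
  have hPc : ContinuousOn P (Ici 0) := (complexify σ).continuous.comp_continuousOn hp
  have hPp := IsPiecewiseCont.of_continuousOn hPc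
  have hPd : ExpDecay P := hpd.clm_comp (complexify σ)
  have hP' (t : ℝ) (ht : 0 ≤ t) : HasDerivWithinAt P (Ac.mulVec (P t) + F t • b) (Ici t) t := by
    refine ((complexify σ).hasFDerivAt.comp_hasDerivWithinAt t (hp' t ht)).congr_deriv ?_
    rw [map_add, complexify_mulVec, complexify_mulVec]
    congr 1
    ext i
    simp [hb, hF, Matrix.mulVec, dotProduct, mul_comm]
  have hAP : IsPiecewiseCont (fun t => mulVecCLM Ac (P t)) :=
    hPp.continuous_comp (mulVecCLM Ac).continuous
  let Lb : ℂ →L[ℂ] (σ → ℂ) := (ContinuousLinearMap.id ℂ ℂ).smulRight b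
  have hFb : IsPiecewiseCont (fun t => Lb (F t)) := hFp.continuous_comp Lb.continuous
  have h1 := halfLineFourier_rightDeriv hPc hP' (by simp [hP, hp0]) hPd
    ((hAP.prodMk hFb).continuous_comp (φ := fun p : (σ → ℂ) × (σ → ℂ) => p.1 + p.2)
      (by fun_prop)) ((hPd.clm_comp (mulVecCLM Ac)).add (hFd.clm_comp Lb)) ω
  have h2 : halfLineFourier ω (fun t => Ac.mulVec (P t) + F t • b) =
      Ac.mulVec (halfLineFourier ω P) + halfLineFourier ω F • b := by
    have e1 := halfLineFourier_add hAP (hPd.clm_comp (mulVecCLM Ac)) hFb (hFd.clm_comp Lb) ω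
    rw [halfLineFourier_clm _ hPp hPd, halfLineFourier_clm _ hFp hFd] at e1
    exact e1
  rw [h2] at h1
  -- the transformed state equation `(iω - A) P̂ = F̂ b` is solved for `P̂`
  have h3 : ((Complex.I * ω) • (1 : Matrix σ σ ℂ) - Ac).mulVec (halfLineFourier ω P) =
      halfLineFourier ω F • b := by
    rw [Matrix.sub_mulVec, Matrix.smul_mulVec, Matrix.one_mulVec, ← h1, add_sub_cancel_left]
  have hu := (Matrix.isUnit_iff_isUnit_det _).1 (hA.isUnit_resolvent ω)
  have h4 : halfLineFourier ω P = halfLineFourier ω F •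
      ((Complex.I * ω) • (1 : Matrix σ σ ℂ) - Ac)⁻¹.mulVec b := by
    rw [← Matrix.mulVec_smul, ← h3, Matrix.mulVec_mulVec, Matrix.nonsing_inv_mul _ hu,
      Matrix.one_mulVec]
  let LC : (σ → ℂ) →L[ℂ] ℂ :=
    (ContinuousLinearMap.proj 0).comp (mulVecCLM (δ.C.map Complex.ofReal))
  let LD : ℂ →L[ℂ] ℂ := (δ.D 0 0 : ℂ) • ContinuousLinearMap.id ℂ ℂ
  have h5 : (fun t => (((δ.C.mulVec (p t) + δ.D.mulVec (fun _ => f t)) 0 : ℝ) : ℂ)) =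
      fun t => LC (P t) + LD (F t) := by
    ext t
    rw [Pi.add_apply, Complex.ofReal_add]
    congr 1
    · exact congrFun (complexify_mulVec δ.C (p t)) 0
    · simp [LD, hF, Matrix.mulVec, dotProduct]
  rw [h5, halfLineFourier_add (hPp.continuous_comp LC.continuous) (hPd.clm_comp LC)
    (hFp.continuous_comp LD.continuous) (hFd.clm_comp LD), halfLineFourier_clm _ hPp hPd,
    halfLineFourier_clm _ hFp hFd, h4, map_smul]
  have h6 : δ.transfer (Complex.I * ω) 0 0 =
      LC (((Complex.I * ω) • (1 : Matrix σ σ ℂ) - Ac)⁻¹.mulVec b) + (δ.D 0 0 : ℂ) := by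
    have e (M : Matrix (Fin 1) (Fin 1) ℂ) : M 0 0 = M.mulVec (fun _ => 1) 0 := by
      simp [Matrix.mulVec, dotProduct]
    rw [LinSys.transfer, Matrix.add_apply, Matrix.map_apply]
    congr 1
    rw [e (δ.C.map Complex.ofReal * _ * _), ← Matrix.mulVec_mulVec, ← Matrix.mulVec_mulVec]
    rfl
  rw [h6]
  simp [LD]
  ring

end Hurwitz

/-- The frequency domain inequality, written out. -/
theorem FDIAt.nonneg {P₀ : Matrix (Fin 2) (Fin 2) ℝ} (hP₀ : P₀.IsSymm) {c : ℂ}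
    (h : FDIAt P₀ c) : 0 ≤ P₀ 0 0 + 2 * P₀ 0 1 * c.re + P₀ 1 1 * ‖c‖ ^ 2 := by
  have e : P₀ 1 0 = P₀ 0 1 := hP₀.apply 0 1
  refine h.le.trans_eq ?_
  rw [Complex.sq_norm, Complex.normSq_apply]
  simp [Matrix.mulVec, dotProduct, Fin.sum_univ_two, e]
  ring

/-- A stable system satisfying the frequency domain inequality satisfies the integral quadratic
constraint on every finite horizon. The input is cut off at time `T`; Plancherel's theorem gives
the constraint on `[0, ∞)`, and since `r ≤ 0` the contribution of the free response after `T` can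
only decrease the integral. -/
theorem SatisfiesFDI.integral_nonneg {N : ℕ} {δ : LinSys (Fin N) (Fin 1) (Fin 1)}
    {P₀ : Matrix (Fin 2) (Fin 2) ℝ} (hδ : SatisfiesFDI P₀ δ) (hP₀ : P₀.IsSymm) (hr : P₀ 1 1 ≤ 0)
    (hA : IsHurwitz δ.A) {p : ℝ → Fin N → ℝ} {v : ℝ → ℝ} (hp : ContinuousOn p (Ici 0))
    (hp' : ∀ t, 0 ≤ t →
      HasDerivWithinAt p (δ.A.mulVec (p t) + δ.B.mulVec (fun _ => v t)) (Ici t) t)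
    (hp0 : p 0 = 0) (hv : IsPiecewiseCont v) {w : ℝ → ℝ}
    (hw : ∀ t, w t = (δ.C.mulVec (p t) + δ.D.mulVec (fun _ => v t)) 0) {T : ℝ} (hT : 0 ≤ T) :
    0 ≤ ∫ t in (0 : ℝ)..T,
      (P₀ 0 0 * v t ^ 2 + 2 * P₀ 0 1 * (v t * w t) + P₀ 1 1 * w t ^ 2) := by
  set f : ℝ → ℝ := (Iio T).indicator v with hf
  set p₁ : ℝ → Fin N → ℝ :=
    fun t => NormedSpace.exp ((max t T - T) • mulVecCLM δ.A) (p (min t T)) with hp₁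
  set w₁ : ℝ → ℝ := fun t => (δ.C.mulVec (p₁ t) + δ.D.mulVec (fun _ => f t)) 0 with hw₁
  have hfp : IsPiecewiseCont f := hv.indicator_Iio T
  have hfd : ExpDecay f := by
    obtain ⟨C, hC⟩ := hv.exists_bound T
    have hC0 : 0 ≤ C := (norm_nonneg _).trans (hC 0 ⟨le_rfl, hT⟩)
    refine ExpDecay.of_shift hT (C₀ := C) (fun t ht => ?_) ExpDecay.zero fun t ht => ?_
    · by_cases h : t ∈ Iio T
      · rw [hf, indicator_of_mem h]; exact hC t ht
      · rw [hf, indicator_of_notMem h]; simpa using hC0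
    · exact indicator_of_notMem (show t ∉ Iio T from not_lt.2 ht) _
  have hp₁c : ContinuousOn p₁ (Ici 0) := continuousOn_freeContinuation (mulVecCLM δ.A) hT hp
  have hp₁d : ExpDecay p₁ := by
    obtain ⟨C, hC⟩ := (IsPiecewiseCont.of_continuousOn hp₁c).exists_bound T
    refine ExpDecay.of_shift hT hC (hA.expDecay_exp (p T)) fun t ht => ?_
    simp only [hp₁]
    rw [max_eq_left ht, min_eq_right ht]
  have hp₁0 : p₁ 0 = 0 := by simp [hp₁, hT, hp0]
  have hp₁' (t : ℝ) (ht : 0 ≤ t) :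
      HasDerivWithinAt p₁ (δ.A.mulVec (p₁ t) + δ.B.mulVec (fun _ => f t)) (Ici t) t := by
    have h := hasDerivWithinAt_freeContinuation (mulVecCLM δ.A)
      (g := fun t => δ.B.mulVec (fun _ => v t)) (T := T) hp' ht
    refine h.congr_deriv ?_
    congr 1
    by_cases h : t ∈ Iio T
    · rw [hf, indicator_of_mem h, indicator_of_mem h]
    · rw [hf, indicator_of_notMem h, indicator_of_notMem h]
      exact (Matrix.mulVec_zero _).symm
  let LC : (Fin N → ℝ) →L[ℝ] ℝ := (ContinuousLinearMap.proj 0).comp (mulVecCLM δ.C)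
  let LD : ℝ →L[ℝ] ℝ := δ.D 0 0 • ContinuousLinearMap.id ℝ ℝ
  have hw₁e : w₁ = fun t => LC (p₁ t) + LD (f t) := by
    ext t
    simp [hw₁, LC, LD, Matrix.mulVec, dotProduct]
  have hw₁p : IsPiecewiseCont w₁ := by
    rw [hw₁e]
    exact ((IsPiecewiseCont.of_continuousOn hp₁c).prodMk hfp).continuous_comp
      (φ := fun p : (Fin N → ℝ) × ℝ => LC p.1 + LD p.2) (by fun_prop)
  have hw₁d : ExpDecay w₁ := by
    rw [hw₁e]
    exact (hp₁d.clm_comp LC).add (hfd.clm_comp LD)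
  have key := integral_quadratic_nonneg_of_frequency hfp hfd hw₁p hw₁d
    (δ := fun ω => δ.transfer (Complex.I * ω) 0 0) (fun ω => (hδ.1 ω).nonneg hP₀)
    (fun ω => halfLineFourier_response δ hA hp₁c hp₁' hp₁0 hp₁d hfp hfd ω)
  set φ : ℝ → ℝ := fun t =>
    P₀ 0 0 * f t ^ 2 + 2 * P₀ 0 1 * (f t * w₁ t) + P₀ 1 1 * w₁ t ^ 2 with hφ
  have hφ₁ : IntegrableOn φ (Ioc 0 T) :=
    ((hfp.prodMk hw₁p).continuous_comp (φ := fun a : ℝ × ℝ =>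
      P₀ 0 0 * a.1 ^ 2 + 2 * P₀ 0 1 * (a.1 * a.2) + P₀ 1 1 * a.2 ^ 2)
      (by fun_prop)).integrableOn T
  -- after time `T` the input vanishes
  have hφe : EqOn φ (fun t => P₀ 1 1 * w₁ t ^ 2) (Ioi T) := by
    intro t (ht : T < t)
    have : f t = 0 := indicator_of_notMem (show t ∉ Iio T from not_lt.2 (le_of_lt ht)) _
    simp [hφ, this]
  have hφ₂ : IntegrableOn φ (Ioi T) := by
    refine IntegrableOn.congr_fun ?_ hφe.symm measurableSet_Ioi
    refine Integrable.const_mul ?_ _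
    exact ((hw₁p.continuous_comp (φ := fun z : ℝ => z ^ 2) (by fun_prop)).integrableOn_Ioi
      (hw₁d.sq_norm.mono fun t _ => by simp)).mono_set (Ioi_subset_Ioi hT)
  have htail : ∫ t in Ioi T, φ t ≤ 0 := by
    rw [setIntegral_congr_fun measurableSet_Ioi hφe]
    exact integral_nonpos fun t => mul_nonpos_of_nonpos_of_nonneg hr (sq_nonneg _)
  rw [← Ioc_union_Ioi_eq_Ioi hT, setIntegral_union (Ioc_disjoint_Ioi le_rfl) measurableSet_Ioi
    hφ₁ hφ₂] at key
  have hhead : ∫ t in Ioc 0 T, φ t = ∫ t in (0 : ℝ)..T,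
      (P₀ 0 0 * v t ^ 2 + 2 * P₀ 0 1 * (v t * w t) + P₀ 1 1 * w t ^ 2) := by
    rw [intervalIntegral.integral_of_le hT, integral_Ioc_eq_integral_Ioo,
      integral_Ioc_eq_integral_Ioo]
    refine setIntegral_congr_fun measurableSet_Ioo fun t ht => ?_
    have e1 : f t = v t := indicator_of_mem (show t ∈ Iio T from ht.2) _
    have e2 : p₁ t = p t := by simp [hp₁, max_eq_right ht.2.le, min_eq_left ht.2.le]
    have e3 : w₁ t = w t := by simp only [hw₁, hw, e1, e2]
    simp only [hφ, e1, e3]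
  rw [← hhead]
  linarith

/-! ### Commutation with the filter and the finite-horizon constraint -/

section Commutation

variable {E σ : Type*} [NormedAddCommGroup E] [NormedSpace ℝ E] [Fintype σ]

/-- Let `ξ` and `x` be the responses at rest of the systems `(F, β)` and `(A, b)` to the same scalar
input `ζ`, and let `Γ` have the rows `Γ j`, the responses of `(A, b)` to the components `ξ j`. Then
the Sylvester identity `ξ bᵀ + Γ Aᵀ = F Γ + β xᵀ` holds along the motion: both
`A (Γ j) + ξ j • b - ∑ k, F j k • Γ k` and `β j • x` solve `ẏ = A y + β j ζ b`. -/
theorem sylvester_of_cascade (A : E →L[ℝ] E) (b : E) (F : Matrix σ σ ℝ) (β : σ → ℝ)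
    {ζ : ℝ → ℝ} {ξ : ℝ → σ → ℝ} {x : ℝ → E} {Γ : σ → ℝ → E}
    (hξ : ContinuousOn ξ (Ici 0))
    (hξ' : ∀ t, 0 ≤ t → HasDerivWithinAt ξ (F.mulVec (ξ t) + ζ t • β) (Ici t) t) (hξ0 : ξ 0 = 0)
    (hx : ContinuousOn x (Ici 0))
    (hx' : ∀ t, 0 ≤ t → HasDerivWithinAt x (A (x t) + ζ t • b) (Ici t) t) (hx0 : x 0 = 0)
    (hΓ : ∀ j, ContinuousOn (Γ j) (Ici 0))
    (hΓ' : ∀ j t, 0 ≤ t → HasDerivWithinAt (Γ j) (A (Γ j t) + ξ t j • b) (Ici t) t)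
    (hΓ0 : ∀ j, Γ j 0 = 0) (j : σ) {t : ℝ} (ht : 0 ≤ t) :
    A (Γ j t) + ξ t j • b = ∑ k, F j k • Γ k t + β j • x t := by
  have hξj (j : σ) : ContinuousOn (fun t => ξ t j) (Ici 0) :=
    (continuous_apply j).comp_continuousOn hξ
  have hξj' (j : σ) (t : ℝ) (ht : 0 ≤ t) :=
    hasDerivWithinAt_pi.1 (hξ' t ht) j
  have h : A (Γ j t) + ξ t j • b - ∑ k, F j k • Γ k t = β j • x t := by
    refine linearODE_unique A (g := fun t => (β j * ζ t) • b)
      (x := fun t => A (Γ j t) + ξ t j • b - ∑ k, F j k • Γ k t) (y := fun t => β j • x t)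
      ?_ ?_ (hx.const_smul _) ?_ (by simp [hΓ0, hξ0, hx0]) ht
    · refine ((A.continuous.comp_continuousOn (hΓ j)).add ((hξj j).smul continuousOn_const)).sub ?_
      exact continuousOn_finsetSum _ fun k _ => (hΓ k).const_smul _
    · intro t ht
      have h1 := (A.hasFDerivAt.comp_hasDerivWithinAt t (hΓ' j t ht)).add
        ((hξj' j t ht).smul_const b) |>.sub
        (HasDerivWithinAt.fun_sum (u := Finset.univ) fun k _ => (hΓ' k t ht).const_smul (F j k))
      refine h1.congr_deriv ?_
      simp only [Pi.add_apply, Pi.smul_apply, smul_eq_mul, Matrix.mulVec, dotProduct, map_add,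
        map_sub, map_sum, map_smul, smul_add, Finset.sum_add_distrib, add_smul, Finset.sum_smul,
        smul_smul, mul_comm (ζ t)]
      abel
    · intro t ht
      refine ((hx' t ht).const_smul (β j)).congr_deriv ?_
      rw [smul_add, map_smul, smul_smul]
  rw [← h]
  abel

/-- Scalar systems commute with a filter: the filter state of the output `w = c x + d ζ` is
`c Γ + d ξ`. -/
theorem hasDerivWithinAt_filterState (A : E →L[ℝ] E) (b : E) (c : E →L[ℝ] ℝ) (d : ℝ)
    (F : Matrix σ σ ℝ) (β : σ → ℝ)
    {ζ : ℝ → ℝ} {ξ : ℝ → σ → ℝ} {x : ℝ → E} {Γ : σ → ℝ → E}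
    (hξ' : ∀ t, 0 ≤ t → HasDerivWithinAt ξ (F.mulVec (ξ t) + ζ t • β) (Ici t) t)
    (hΓ' : ∀ j t, 0 ≤ t → HasDerivWithinAt (Γ j) (A (Γ j t) + ξ t j • b) (Ici t) t)
    (hS : ∀ j t, 0 ≤ t → A (Γ j t) + ξ t j • b = ∑ k, F j k • Γ k t + β j • x t)
    {t : ℝ} (ht : 0 ≤ t) :
    HasDerivWithinAt (fun t j => c (Γ j t) + d * ξ t j)
      (F.mulVec (fun j => c (Γ j t) + d * ξ t j) + (c (x t) + d * ζ t) • β) (Ici t) t := by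
  refine hasDerivWithinAt_pi.2 fun j => ?_
  have h1 := (c.hasFDerivAt.comp_hasDerivWithinAt t (hΓ' j t ht)).add
    ((hasDerivWithinAt_pi.1 (hξ' t ht) j).const_mul d)
  refine h1.congr_deriv ?_
  rw [hS j t ht]
  simp only [Pi.add_apply, Pi.smul_apply, smul_eq_mul, Matrix.mulVec, dotProduct, map_add, map_sum,
    map_smul, mul_add, Finset.sum_add_distrib, Finset.mul_sum]
  have e : ∀ k, d * (F j k * ξ t k) = F j k * (d * ξ t k) := fun k => by ring
  simp only [e]
  ring

/-- The response of `(A, b)` to a fixed combination of the filter state `ξ` and the input `ζ`. -/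
theorem hasDerivWithinAt_combination (A : E →L[ℝ] E) (b : E) (R : σ ⊕ Fin 1 → ℝ)
    {ζ : ℝ → ℝ} {ξ : ℝ → σ → ℝ} {x : ℝ → E} {Γ : σ → ℝ → E}
    (hx' : ∀ t, 0 ≤ t → HasDerivWithinAt x (A (x t) + ζ t • b) (Ici t) t)
    (hΓ' : ∀ j t, 0 ≤ t → HasDerivWithinAt (Γ j) (A (Γ j t) + ξ t j • b) (Ici t) t)
    {t : ℝ} (ht : 0 ≤ t) :
    HasDerivWithinAt (fun t => ∑ j, R (Sum.inl j) • Γ j t + R (Sum.inr 0) • x t)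
      (A (∑ j, R (Sum.inl j) • Γ j t + R (Sum.inr 0) • x t)
        + (R ⬝ᵥ Sum.elim (ξ t) (fun _ => ζ t)) • b) (Ici t) t := by
  have h := (HasDerivWithinAt.fun_sum (u := Finset.univ) fun j _ =>
    (hΓ' j t ht).const_smul (R (Sum.inl j))).add ((hx' t ht).const_smul (R (Sum.inr 0)))
  refine h.congr_deriv ?_
  simp only [dotProduct, Fintype.sum_sum_type, Sum.elim_inl, Sum.elim_inr,
    Finset.univ_unique, Fin.default_eq_zero, Finset.sum_singleton, smul_add,
    Finset.sum_add_distrib, map_add, map_sum, map_smul, add_smul, Finset.sum_smul, smul_smul]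
  abel

/-- The output of `(A, b, c, d)` for a combination of the filter state and the input is the same
combination of `c Γ + d ξ` and `c x + d ζ`. -/
theorem output_combination (c : E →L[ℝ] ℝ) (d : ℝ) (R : σ ⊕ Fin 1 → ℝ) (ξ : σ → ℝ) (ζ : ℝ) (x : E)
    (Γ : σ → E) :
    c (∑ j, R (Sum.inl j) • Γ j + R (Sum.inr 0) • x) + d * (R ⬝ᵥ Sum.elim ξ (fun _ => ζ)) =
      R ⬝ᵥ Sum.elim (fun j => c (Γ j) + d * ξ j) (fun _ => c x + d * ζ) := by
  simp only [dotProduct, Fintype.sum_sum_type, Sum.elim_inl, Sum.elim_inr, Finset.univ_unique,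
    Fin.default_eq_zero, Finset.sum_singleton, map_add, map_sum, map_smul, smul_eq_mul, mul_add,
    Finset.sum_add_distrib, Finset.mul_sum]
  have e : ∀ j, d * (R (Sum.inl j) * ξ j) = R (Sum.inl j) * (d * ξ j) := fun j => by ring
  simp only [e]
  ring

end Commutation

theorem mulVec_fin_one {m : Type*} (B : Matrix m (Fin 1) ℝ) (u : Fin 1 → ℝ) :
    B.mulVec u = u 0 • fun i => B i 0 := by
  ext i
  simp [Matrix.mulVec, dotProduct, mul_comm]

theorem IsPiecewiseCont.sumElim {ι κ : Type*} {u : ℝ → ι → ℝ} {v : ℝ → κ → ℝ}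
    (hu : IsPiecewiseCont u) (hv : IsPiecewiseCont v) :
    IsPiecewiseCont (fun t => Sum.elim (u t) (v t)) :=
  (hu.prodMk hv).continuous_comp (φ := fun p : (ι → ℝ) × (κ → ℝ) => Sum.elim p.1 p.2)
    (continuous_pi fun i => by rcases i with i | i <;> simp <;> fun_prop)

theorem continuous_bilin {ι : Type*} [Fintype ι] (N : Matrix ι ι ℝ) :
    Continuous (fun p : (ι → ℝ) × (ι → ℝ) => p.1 ⬝ᵥ N.mulVec p.2) := by
  have := continuous_mulVec N
  simp only [dotProduct]
  fun_prop

/-- Each scalar combination of a filter state and its input satisfies the integral quadratic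
constraint of the uncertainty. -/
theorem SatisfiesFDI.integral_combination_nonneg {σ : Type*} [Fintype σ] {N : ℕ}
    {δ : LinSys (Fin N) (Fin 1) (Fin 1)}
    {P₀ : Matrix (Fin 2) (Fin 2) ℝ} (hδ : SatisfiesFDI P₀ δ) (hP₀ : P₀.IsSymm) (hr : P₀ 1 1 ≤ 0)
    (hA : IsHurwitz δ.A) {b : Fin N → ℝ} (hb : b = fun i => δ.B i 0)
    {c : (Fin N → ℝ) →L[ℝ] ℝ} (hc : ∀ y, c y = δ.C.mulVec y 0) {d : ℝ} (hd : d = δ.D 0 0)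
    {ζ : ℝ → ℝ} {ξ : ℝ → σ → ℝ} {x : ℝ → Fin N → ℝ} {Γ : σ → ℝ → Fin N → ℝ}
    (hζ : IsPiecewiseCont ζ) (hξ : ContinuousOn ξ (Ici 0)) (hx : ContinuousOn x (Ici 0))
    (hx' : ∀ t, 0 ≤ t → HasDerivWithinAt x (mulVecCLM δ.A (x t) + ζ t • b) (Ici t) t)
    (hx0 : x 0 = 0) (hΓ : ∀ j, ContinuousOn (Γ j) (Ici 0))
    (hΓ' : ∀ j t, 0 ≤ t →
      HasDerivWithinAt (Γ j) (mulVecCLM δ.A (Γ j t) + ξ t j • b) (Ici t) t)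
    (hΓ0 : ∀ j, Γ j 0 = 0) (R : σ ⊕ Fin 1 → ℝ) {v w : ℝ → ℝ}
    (hv : ∀ t, 0 ≤ t → v t = R ⬝ᵥ Sum.elim (ξ t) (fun _ => ζ t))
    (hw : ∀ t, 0 ≤ t → w t =
      R ⬝ᵥ Sum.elim (fun j => c (Γ j t) + d * ξ t j) (fun _ => c (x t) + d * ζ t))
    {T : ℝ} (hT : 0 ≤ T) :
    0 ≤ ∫ t in (0 : ℝ)..T,
      (P₀ 0 0 * v t ^ 2 + 2 * P₀ 0 1 * (v t * w t) + P₀ 1 1 * w t ^ 2) := by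
  have hvp : IsPiecewiseCont v := by
    refine IsPiecewiseCont.congr ?_ hv
    refine ((IsPiecewiseCont.of_continuousOn hξ).prodMk hζ).continuous_comp
      (φ := fun p : (σ → ℝ) × ℝ => R ⬝ᵥ Sum.elim p.1 (fun _ => p.2)) ?_
    simp only [dotProduct, Fintype.sum_sum_type, Sum.elim_inl, Sum.elim_inr]
    fun_prop
  have hpc : ContinuousOn (fun t => ∑ j, R (Sum.inl j) • Γ j t + R (Sum.inr 0) • x t) (Ici 0) := by
    refine ContinuousOn.fun_add (continuousOn_finsetSum _ fun j _ => ?_) (hx.fun_const_smul _)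
    exact (hΓ j).fun_const_smul _
  have hp' (t : ℝ) (ht : 0 ≤ t) : HasDerivWithinAt
      (fun t => ∑ j, R (Sum.inl j) • Γ j t + R (Sum.inr 0) • x t)
      (δ.A.mulVec (∑ j, R (Sum.inl j) • Γ j t + R (Sum.inr 0) • x t) +
        δ.B.mulVec (fun _ => v t)) (Ici t) t := by
    have h1 := hasDerivWithinAt_combination (mulVecCLM δ.A) b R hx' hΓ' ht
    refine h1.congr_deriv ?_
    rw [mulVec_fin_one, ← hb, hv t ht, mulVecCLM_apply]
  have h := hδ.integral_nonneg hP₀ hr hA hpc hp' (by simp [hΓ0, hx0]) hvp (fun _ => rfl) hT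
  refine h.trans_eq (intervalIntegral.integral_congr fun t ht => ?_)
  rw [uIcc_of_le hT] at ht
  have e : (δ.C.mulVec (∑ j, R (Sum.inl j) • Γ j t + R (Sum.inr 0) • x t) +
      δ.D.mulVec fun _ => v t) 0 = w t := by
    rw [Pi.add_apply, mulVec_fin_one, ← hc, hw t ht.1]
    refine Eq.trans ?_ (output_combination c d R (ξ t) (ζ t) (x t) (fun j => Γ j t))
    rw [← hv t ht.1, hd, Pi.smul_apply, smul_eq_mul, mul_comm (v t)]
  simp only [e]

open scoped MatrixOrder Matrix.Norms.L2Operator in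
theorem posSemidef_exists_eq_star_mul_self {ι : Type*} [Fintype ι] [DecidableEq ι]
    {N : Matrix ι ι ℝ} (hN : N.PosSemidef) : ∃ R : Matrix ι ι ℝ, N = star R * R :=
  CStarAlgebra.nonneg_iff_eq_star_mul_self.1 hN.nonneg

/-- **Finite-horizon integral quadratic constraint.** For `w ∈ Δ(z)` filter both signals at rest
with `(A_ψ, B_ψ)`, and let `ζ_z = (ξ_z, z)`, `ζ_w = (ξ_w, w)`. Then the form `P₀ ⊗ N` has a
nonnegative integral along `(ζ_z, ζ_w)` for every positive semidefinite `N`: with `N = Rᵀ R` each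
component of `R ζ_w` is the response of the uncertainty to the same component of `R ζ_z`. -/
theorem exists_filterStates_integral_nonneg {σ κ : Type*} [Fintype σ] [DecidableEq σ]
    {P₀ : Matrix (Fin 2) (Fin 2) ℝ}
    (hP₀ : P₀.IsSymm) (hr : P₀ 1 1 ≤ 0) (ψ : LinSys σ (Fin 1) κ) {z w : ℝ → Fin 1 → ℝ}
    (hz : IsSignal z) (hw : w ∈ dynUncertainty P₀ z) :
    ∃ ξz ξw : ℝ → σ → ℝ, ContinuousOn ξz (Ici 0) ∧ ContinuousOn ξw (Ici 0) ∧
      (∀ t, 0 ≤ t → HasDerivWithinAt ξz (ψ.A.mulVec (ξz t) + ψ.B.mulVec (z t)) (Ici t) t) ∧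
      (∀ t, 0 ≤ t → HasDerivWithinAt ξw (ψ.A.mulVec (ξw t) + ψ.B.mulVec (w t)) (Ici t) t) ∧
      ξz 0 = 0 ∧ ξw 0 = 0 ∧
      ∀ N : Matrix (σ ⊕ Fin 1) (σ ⊕ Fin 1) ℝ, N.PosSemidef → ∀ T, 0 ≤ T →
        0 ≤ ∫ t in (0 : ℝ)..T,
          (P₀ 0 0 * (Sum.elim (ξz t) (z t) ⬝ᵥ N.mulVec (Sum.elim (ξz t) (z t)))
          + 2 * P₀ 0 1 * (Sum.elim (ξz t) (z t) ⬝ᵥ N.mulVec (Sum.elim (ξw t) (w t)))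
          + P₀ 1 1 * (Sum.elim (ξw t) (w t) ⬝ᵥ N.mulVec (Sum.elim (ξw t) (w t)))) := by
  obtain ⟨hws, n, δ, -, hA, hδ, x, hx, hx0, hwx⟩ := hw
  set A := mulVecCLM δ.A
  set b : Fin n → ℝ := fun i => δ.B i 0 with hb
  set β : σ → ℝ := fun i => ψ.B i 0 with hβ
  have hx' (t : ℝ) (ht : 0 ≤ t) : HasDerivWithinAt x (A (x t) + z t 0 • b) (Ici t) t := by
    have := hx.hasRightDeriv t ht
    rwa [mulVec_fin_one δ.B] at this
  let c : (Fin n → ℝ) →L[ℝ] ℝ := (ContinuousLinearMap.proj 0).comp (mulVecCLM δ.C)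
  set d : ℝ := δ.D 0 0 with hd
  have hw0 (t : ℝ) (ht : 0 ≤ t) : w t = fun _ => c (x t) + d * z t 0 := by
    rw [hwx t ht, mulVec_fin_one δ.D]
    ext i
    fin_cases i
    simp [c, hd, mul_comm]
  have hzp := hz.isPiecewiseCont
  obtain ⟨ξ, hξ, hξ', hξ0⟩ := exists_linearODE (mulVecCLM ψ.A) (g := fun t => z t 0 • β)
    (hzp.continuous_comp (φ := fun u : Fin 1 → ℝ => u 0 • β) (by fun_prop))
  have hΓex (j : σ) := exists_linearODE A (g := fun t => ξ t j • b)
    ((IsPiecewiseCont.of_continuousOn hξ).continuous_comp (φ := fun u : σ → ℝ => u j • b)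
      (by fun_prop))
  choose Γ hΓ hΓ' hΓ0 using hΓex
  have hS (j : σ) (t : ℝ) (ht : 0 ≤ t) := sylvester_of_cascade A b ψ.A β hξ hξ' hξ0
    hx.continuousOn hx' hx0 hΓ hΓ' hΓ0 j ht
  set ξw : ℝ → σ → ℝ := fun t j => c (Γ j t) + d * ξ t j with hξw
  have hξwc : ContinuousOn ξw (Ici 0) := continuousOn_pi.2 fun j =>
    (c.continuous.comp_continuousOn (hΓ j)).add
      (((continuous_apply j).comp_continuousOn hξ).const_mul d)
  refine ⟨ξ, ξw, hξ, hξwc, ?_, ?_, hξ0, ?_, ?_⟩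
  · intro t ht
    rw [mulVec_fin_one ψ.B]
    exact hξ' t ht
  · intro t ht
    rw [mulVec_fin_one ψ.B, hw0 t ht]
    exact hasDerivWithinAt_filterState A b c d ψ.A β hξ' hΓ' hS ht
  · ext j
    simp [hξw, hΓ0, hξ0]
  · intro N hN T hT
    classical
    obtain ⟨R, rfl⟩ := posSemidef_exists_eq_star_mul_self hN
    have hζz : IsPiecewiseCont (fun t => Sum.elim (ξ t) (z t)) :=
      (IsPiecewiseCont.of_continuousOn hξ).sumElim hzp
    have hζw : IsPiecewiseCont (fun t => Sum.elim (ξw t) (w t)) :=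
      (IsPiecewiseCont.of_continuousOn hξwc).sumElim hws.isPiecewiseCont
    have hz1 (t : ℝ) : (fun _ => z t 0) = z t := by
      ext i; fin_cases i; rfl
    have hi (i : σ ⊕ Fin 1) : 0 ≤ ∫ t in (0 : ℝ)..T,
        (P₀ 0 0 * (R.mulVec (Sum.elim (ξ t) (z t)) i) ^ 2
        + 2 * P₀ 0 1 * (R.mulVec (Sum.elim (ξ t) (z t)) i * R.mulVec (Sum.elim (ξw t) (w t)) i)
        + P₀ 1 1 * (R.mulVec (Sum.elim (ξw t) (w t)) i) ^ 2) := by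
      refine hδ.integral_combination_nonneg hP₀ hr hA hb (c := c) (fun _ => rfl) hd
        (hzp.continuous_comp (continuous_apply 0)) hξ hx.continuousOn hx' hx0 hΓ hΓ' hΓ0 (R i)
        (fun t _ => ?_) (fun t ht => ?_) hT
      · rw [hz1]
        rfl
      · rw [hw0 t ht]
        rfl
    have hsum := Finset.sum_nonneg fun i (_ : i ∈ Finset.univ) => hi i
    rw [← intervalIntegral.integral_finsetSum] at hsum
    · refine hsum.trans_eq (intervalIntegral.integral_congr fun t _ => ?_)
      have e (a a' : σ ⊕ Fin 1 → ℝ) : a ⬝ᵥ (star R * R).mulVec a' =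
          ∑ i, R.mulVec a i * R.mulVec a' i := by
        rw [← Matrix.mulVec_mulVec, Matrix.star_eq_conjTranspose,
          Matrix.conjTranspose_eq_transpose_of_trivial, Matrix.dotProduct_mulVec,
          Matrix.vecMul_transpose]
        rfl
      simp only [e, Finset.mul_sum, ← Finset.sum_add_distrib, sq]
    · intro i _
      exact ((hζz.prodMk hζw).continuous_comp
        (φ := fun p : (σ ⊕ Fin 1 → ℝ) × (σ ⊕ Fin 1 → ℝ) => P₀ 0 0 * (R.mulVec p.1 i) ^ 2
        + 2 * P₀ 0 1 * (R.mulVec p.1 i * R.mulVec p.2 i) + P₀ 1 1 * (R.mulVec p.2 i) ^ 2)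
        (by
          have h1 : Continuous fun p : (σ ⊕ Fin 1 → ℝ) × (σ ⊕ Fin 1 → ℝ) => R.mulVec p.1 i :=
            (continuous_apply i).comp ((continuous_mulVec R).comp continuous_fst)
          have h2 : Continuous fun p : (σ ⊕ Fin 1 → ℝ) × (σ ⊕ Fin 1 → ℝ) => R.mulVec p.2 i :=
            (continuous_apply i).comp ((continuous_mulVec R).comp continuous_snd)
          fun_prop)).intervalIntegrable hT

/-! ### Quadratic forms and the matrix inequalities -/

section QuadraticForms

variable {ι κ : Type*} [Fintype ι] [Fintype κ]

theorem quadForm_congruence (L : Matrix κ ι ℝ) (P : Matrix κ κ ℝ) (v : ι → ℝ) :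
    quadForm (L.transpose * P * L) v = quadForm P (L.mulVec v) := by
  simp only [quadForm, ← Matrix.mulVec_mulVec, Matrix.dotProduct_mulVec, Matrix.vecMul_transpose]

theorem bilin_congruence (L : Matrix κ ι ℝ) (P : Matrix κ κ ℝ) (v v' : ι → ℝ) :
    v ⬝ᵥ (L.transpose * P * L).mulVec v' = L.mulVec v ⬝ᵥ P.mulVec (L.mulVec v') := by
  simp only [← Matrix.mulVec_mulVec, Matrix.dotProduct_mulVec, Matrix.vecMul_transpose]

theorem bilin_offDiag (X : Matrix ι ι ℝ) (a b a' b' : ι → ℝ) :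
    Sum.elim a b ⬝ᵥ (Matrix.fromBlocks 0 X X 0).mulVec (Sum.elim a' b') =
      a ⬝ᵥ X.mulVec b' + b ⬝ᵥ X.mulVec a' := by
  simp [Matrix.fromBlocks_mulVec]

theorem bilin_comm {M : Matrix ι ι ℝ} (hM : M.IsSymm) (a b : ι → ℝ) :
    a ⬝ᵥ M.mulVec b = b ⬝ᵥ M.mulVec a := by
  rw [Matrix.dotProduct_mulVec, ← Matrix.mulVec_transpose, hM.eq, dotProduct_comm]

theorem quadForm_kron {P₀ : Matrix (Fin 2) (Fin 2) ℝ} (hP₀ : P₀.IsSymm) {M : Matrix ι ι ℝ}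
    (hM : M.IsSymm) (a b : ι → ℝ) :
    quadForm (kron P₀ M) (Sum.elim a b) = P₀ 0 0 * (a ⬝ᵥ M.mulVec a)
      + 2 * P₀ 0 1 * (a ⬝ᵥ M.mulVec b) + P₀ 1 1 * (b ⬝ᵥ M.mulVec b) := by
  have e : P₀ 1 0 = P₀ 0 1 := hP₀.apply 0 1
  rw [quadForm, kron_eq_fromBlocks, Matrix.fromBlocks_mulVec, e]
  simp only [Sum.elim_comp_inl, Sum.elim_comp_inr, sumElim_dotProduct_sumElim, dotProduct_add,
    Matrix.smul_mulVec, dotProduct_smul, smul_eq_mul, bilin_comm hM b a]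
  ring

theorem continuous_quadForm (P : Matrix ι ι ℝ) : Continuous (quadForm P) := by
  have := (continuous_bilin P).comp (continuous_id.prodMk continuous_id)
  exact this

theorem hasDerivWithinAt_bilin (K : Matrix ι ι ℝ) {a b : ℝ → ι → ℝ} {a' b' : ι → ℝ} {s : Set ℝ}
    {t : ℝ} (ha : HasDerivWithinAt a a' s t) (hb : HasDerivWithinAt b b' s t) :
    HasDerivWithinAt (fun t => a t ⬝ᵥ K.mulVec (b t))
      (a' ⬝ᵥ K.mulVec (b t) + a t ⬝ᵥ K.mulVec b') s t := by
  have hKb : HasDerivWithinAt (fun t => K.mulVec (b t)) (K.mulVec b') s t :=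
    (mulVecCLM K).hasFDerivAt.comp_hasDerivWithinAt t hb
  have h := HasDerivWithinAt.fun_sum (u := Finset.univ) fun i _ =>
    (hasDerivWithinAt_pi.1 ha i).fun_mul (hasDerivWithinAt_pi.1 hKb i)
  refine h.congr_deriv ?_
  simp [dotProduct, Finset.sum_add_distrib]

theorem quadForm_nonneg {P : Matrix ι ι ℝ} (hP : P.PosSemidef) (v : ι → ℝ) : 0 ≤ quadForm P v := by
  simpa using! hP.dotProduct_mulVec_nonneg v

end QuadraticForms

section SchurComplement

variable {ξ ν : Type*}
  {X : Matrix (ξ ⊕ ν) (ξ ⊕ ν) ℝ} {Z : Matrix ξ ξ ℝ}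

theorem CouplingPos.posDef_block (h : CouplingPos X Z) : (X.toBlocks₁₁ + Z).PosDef := by
  have := Matrix.PosDef.submatrix h (e := Sum.inl) Sum.inl_injective
  exact this

/-- Completion of squares: minimizing the coupled form over the filter state leaves the Schur
complement. -/
theorem CouplingPos.quadForm_eq [Fintype ξ] [DecidableEq ξ] [Fintype ν] (h : CouplingPos X Z)
    (a : ξ → ℝ) (x : ν → ℝ) :
    quadForm (Matrix.fromBlocks (X.toBlocks₁₁ + Z) X.toBlocks₁₂ X.toBlocks₁₂.transpose
      X.toBlocks₂₂) (Sum.elim a x) =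
    quadForm (X.toBlocks₁₁ + Z) (a + ((X.toBlocks₁₁ + Z)⁻¹ * X.toBlocks₁₂).mulVec x) +
      quadForm (schurE X Z) x := by
  have hp := h.posDef_block
  have := hp.isUnit.invertible
  have e := Matrix.schur_complement_eq₁₁ X.toBlocks₁₂ X.toBlocks₂₂ a x hp.1
  simp only [star_trivial, ← Matrix.dotProduct_mulVec,
    Matrix.conjTranspose_eq_transpose_of_trivial] at e
  exact e

theorem CouplingPos.quadForm_schurE_le [Fintype ξ] [DecidableEq ξ] [Fintype ν]
    (h : CouplingPos X Z) (a : ξ → ℝ) (x : ν → ℝ) :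
    quadForm (schurE X Z) x ≤ quadForm (Matrix.fromBlocks (X.toBlocks₁₁ + Z) X.toBlocks₁₂
      X.toBlocks₁₂.transpose X.toBlocks₂₂) (Sum.elim a x) := by
  rw [h.quadForm_eq]
  exact le_add_of_nonneg_left (quadForm_nonneg h.posDef_block.posSemidef _)

theorem CouplingPos.posDef_schurE [Fintype ξ] [DecidableEq ξ] [Fintype ν] (h : CouplingPos X Z) :
    (schurE X Z).PosDef := by
  have hp := h.posDef_block
  refine Matrix.PosDef.of_dotProduct_mulVec_pos ?_ fun x hx => ?_
  · have h2 : X.toBlocks₂₂.IsHermitian := by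
      have := Matrix.PosDef.isHermitian
        (Matrix.PosDef.submatrix h (e := Sum.inr) Sum.inr_injective)
      exact this
    have h3 := Matrix.isHermitian_conjTranspose_mul_mul X.toBlocks₁₂ hp.isHermitian.inv
    rw [Matrix.conjTranspose_eq_transpose_of_trivial] at h3
    exact h2.sub h3
  -- the filter state that minimizes the coupled form for given `x`
  · have e := h.quadForm_eq (-((X.toBlocks₁₁ + Z)⁻¹ * X.toBlocks₁₂).mulVec x) x
    rw [neg_add_cancel] at e
    have e0 : quadForm (X.toBlocks₁₁ + Z) 0 = 0 := by simp [quadForm]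
    rw [e0, zero_add] at e
    have hpos := Matrix.PosDef.dotProduct_mulVec_pos h
      (x := Sum.elim (-((X.toBlocks₁₁ + Z)⁻¹ * X.toBlocks₁₂).mulVec x) x) (fun h0 => hx (by
        ext i
        exact congrFun h0 (Sum.inr i)))
    exact hpos.trans_eq e

/-- The coupled form is the sum of the storage form `X` and the terminal cost `Z`. -/
theorem quadForm_coupling [Fintype ξ] [Fintype ν] (hX : X.IsSymm) (a : ξ → ℝ) (x : ν → ℝ) :
    quadForm (Matrix.fromBlocks (X.toBlocks₁₁ + Z) X.toBlocks₁₂ X.toBlocks₁₂.transpose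
      X.toBlocks₂₂) (Sum.elim a x) = quadForm X (Sum.elim a x) + quadForm Z a := by
  have h21 : X.toBlocks₂₁ = X.toBlocks₁₂.transpose := by
    ext i j
    exact hX.apply _ _
  have e : quadForm X (Sum.elim a x) = quadForm (Matrix.fromBlocks X.toBlocks₁₁ X.toBlocks₁₂
      X.toBlocks₁₂.transpose X.toBlocks₂₂) (Sum.elim a x) := by
    rw [← h21, Matrix.fromBlocks_toBlocks]
  rw [e]
  simp only [quadForm, Matrix.fromBlocks_mulVec, Sum.elim_comp_inl, Sum.elim_comp_inr,
    sumElim_dotProduct_sumElim, Matrix.add_mulVec, dotProduct_add]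
  ring

end SchurComplement

section Loop

variable {σ p ν η ε : Type*} [Fintype σ] [Fintype ν] [Fintype η]

theorem mulVec_sumElim {m n₁ n₂ : Type*} [Fintype n₁] [Fintype n₂] (M : Matrix m (n₁ ⊕ n₂) ℝ)
    (a : n₁ → ℝ) (b : n₂ → ℝ) :
    M.mulVec (Sum.elim a b) = M.toCols₁.mulVec a + M.toCols₂.mulVec b := by
  ext i
  simp [Matrix.mulVec, dotProduct, Fintype.sum_sum_type, Matrix.toCols₁, Matrix.toCols₂]

variable (ψ : LinSys σ (Fin 1) p) (G : Plant ν (Fin 1) (Fin 1) η ε)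

theorem outerState_mulVec [DecidableEq σ] [DecidableEq ν] (ξz ξw : σ → ℝ) (x : ν → ℝ)
    (w : Fin 1 → ℝ) (d : η → ℝ) {z : Fin 1 → ℝ}
    (hz : z = G.C.mulVec x + G.D.mulVec w + G.Dd.mulVec d) :
    (outerState ψ.double G).mulVec (Sum.elim (Sum.elim (Sum.elim ξz ξw) x) (Sum.elim w d)) =
      Sum.elim (Sum.elim (Sum.elim (ψ.A.mulVec ξz + ψ.B.mulVec z) (ψ.A.mulVec ξw + ψ.B.mulVec w))
        (G.A.mulVec x + G.B.mulVec w + G.Bd.mulVec d)) (Sum.elim (Sum.elim ξz ξw) x) := by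
  have hB : ψ.double.B.toCols₁.mulVec z + ψ.double.B.toCols₂.mulVec w =
      Sum.elim (ψ.B.mulVec z) (ψ.B.mulVec w) := by
    rw [← mulVec_sumElim]
    simp [LinSys.double, Matrix.fromBlocks_mulVec]
  have hA : ψ.double.A.mulVec (Sum.elim ξz ξw) = Sum.elim (ψ.A.mulVec ξz) (ψ.A.mulVec ξw) := by
    simp [LinSys.double, Matrix.fromBlocks_mulVec]
  have h1 : ψ.double.A.mulVec (Sum.elim ξz ξw) + (ψ.double.B.toCols₁ * G.C).mulVec x +
      ((ψ.double.B.toCols₁ * G.D + ψ.double.B.toCols₂).mulVec w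
        + (ψ.double.B.toCols₁ * G.Dd).mulVec d) =
      Sum.elim (ψ.A.mulVec ξz + ψ.B.mulVec z) (ψ.A.mulVec ξw + ψ.B.mulVec w) := by
    have e : Sum.elim (ψ.A.mulVec ξz + ψ.B.mulVec z) (ψ.A.mulVec ξw + ψ.B.mulVec w) =
        Sum.elim (ψ.A.mulVec ξz) (ψ.A.mulVec ξw) + Sum.elim (ψ.B.mulVec z) (ψ.B.mulVec w) := by
      ext (i | i) <;> rfl
    rw [e, ← hA, ← hB, hz]
    simp only [Matrix.add_mulVec, Matrix.mulVec_add, ← Matrix.mulVec_mulVec]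
    abel
  have h2 : G.A.mulVec x + (G.B.mulVec w + G.Bd.mulVec d) =
      G.A.mulVec x + G.B.mulVec w + G.Bd.mulVec d := by abel
  rw [outerState, Matrix.fromBlocks_mulVec]
  simp only [Sum.elim_comp_inl, Sum.elim_comp_inr, Matrix.fromBlocks_mulVec, Matrix.one_mulVec,
    Matrix.zero_mulVec, add_zero, zero_add]
  rw [← h1, ← h2]
  congr 1
  ext (i | i) <;> rfl

theorem outerFilter_mulVec (ξz ξw : σ → ℝ) (x : ν → ℝ) (w : Fin 1 → ℝ) (d : η → ℝ)
    {z : Fin 1 → ℝ} (hz : z = G.C.mulVec x + G.D.mulVec w + G.Dd.mulVec d) :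
    (outerFilter ψ.double G).mulVec (Sum.elim (Sum.elim (Sum.elim ξz ξw) x) (Sum.elim w d)) =
      Sum.elim (ψ.C.mulVec ξz + ψ.D.mulVec z) (ψ.C.mulVec ξw + ψ.D.mulVec w) := by
  have hD : ψ.double.D.toCols₁.mulVec z + ψ.double.D.toCols₂.mulVec w =
      Sum.elim (ψ.D.mulVec z) (ψ.D.mulVec w) := by
    rw [← mulVec_sumElim]
    simp [LinSys.double, Matrix.fromBlocks_mulVec]
  have hC : ψ.double.C.mulVec (Sum.elim ξz ξw) = Sum.elim (ψ.C.mulVec ξz) (ψ.C.mulVec ξw) := by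
    simp [LinSys.double, Matrix.fromBlocks_mulVec]
  have e : Sum.elim (ψ.C.mulVec ξz + ψ.D.mulVec z) (ψ.C.mulVec ξw + ψ.D.mulVec w) =
      Sum.elim (ψ.C.mulVec ξz) (ψ.C.mulVec ξw) + Sum.elim (ψ.D.mulVec z) (ψ.D.mulVec w) := by
    ext (i | i) <;> rfl
  rw [e, ← hC, ← hD, hz, outerFilter]
  simp only [Matrix.fromCols_mulVec, Sum.elim_comp_inl, Sum.elim_comp_inr, Matrix.add_mulVec,
    Matrix.mulVec_add, ← Matrix.mulVec_mulVec]
  abel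

theorem outerPerf_mulVec [DecidableEq η] (ξ : σ ⊕ σ → ℝ) (x : ν → ℝ) (w : Fin 1 → ℝ) (d : η → ℝ)
    {e : ε → ℝ} (he : e = G.Ce.mulVec x + G.De.mulVec w + G.Ded.mulVec d) :
    (outerPerf (σ ⊕ σ) G).mulVec (Sum.elim (Sum.elim ξ x) (Sum.elim w d)) = Sum.elim e d := by
  rw [outerPerf, Matrix.fromBlocks_mulVec, he]
  simp only [Matrix.fromCols_mulVec, Sum.elim_comp_inl, Sum.elim_comp_inr, Matrix.zero_mulVec,
    zero_add, Matrix.one_mulVec, add_assoc]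

/-- The certificate form along two filter motions: filter outputs weighted with `M`, minus the
derivative of the form of `K`. -/
theorem certificate_bilin [DecidableEq σ] [Fintype p] (K : Matrix σ σ ℝ) (M : Matrix p p ℝ)
    (a b : σ → ℝ) (u v : Fin 1 → ℝ) :
    Sum.elim a u ⬝ᵥ ((Matrix.fromCols ψ.C ψ.D).transpose * M * Matrix.fromCols ψ.C ψ.D
      - (outerCert ψ).transpose * Matrix.fromBlocks 0 K K 0 * outerCert ψ).mulVec (Sum.elim b v) =
    (ψ.C.mulVec a + ψ.D.mulVec u) ⬝ᵥ M.mulVec (ψ.C.mulVec b + ψ.D.mulVec v)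
      - ((ψ.A.mulVec a + ψ.B.mulVec u) ⬝ᵥ K.mulVec b
        + a ⬝ᵥ K.mulVec (ψ.A.mulVec b + ψ.B.mulVec v)) := by
  have h (a : σ → ℝ) (u : Fin 1 → ℝ) : (outerCert ψ).mulVec (Sum.elim a u) =
      Sum.elim (ψ.A.mulVec a + ψ.B.mulVec u) a := by
    simp [outerCert, Matrix.fromBlocks_mulVec]
  rw [Matrix.sub_mulVec, dotProduct_sub, bilin_congruence, bilin_congruence, h, h, bilin_offDiag]
  simp [Matrix.fromCols_mulVec]

/-- The performance LMI evaluated along a trajectory of the loop and the filter. -/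
theorem PerformanceLMI.pointwise [DecidableEq σ] [Fintype p] [DecidableEq ν] [DecidableEq η]
    [Fintype ε] {ψ : LinSys σ (Fin 1) p} {G : Plant ν (Fin 1) (Fin 1) η ε}
    {Pp : Matrix (ε ⊕ η) (ε ⊕ η) ℝ} {X : Matrix ((σ ⊕ σ) ⊕ ν) ((σ ⊕ σ) ⊕ ν) ℝ}
    {P : Matrix (p ⊕ p) (p ⊕ p) ℝ} (h : PerformanceLMI ψ.double G Pp X P)
    (ξz ξw : σ → ℝ) (x : ν → ℝ) (w : Fin 1 → ℝ) (d : η → ℝ) {z : Fin 1 → ℝ} {e : ε → ℝ}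
    (hz : z = G.C.mulVec x + G.D.mulVec w + G.Dd.mulVec d)
    (he : e = G.Ce.mulVec x + G.De.mulVec w + G.Ded.mulVec d) {χ χ' : (σ ⊕ σ) ⊕ ν → ℝ}
    (hχ : χ = Sum.elim (Sum.elim ξz ξw) x)
    (hχ' : χ' = Sum.elim (Sum.elim (ψ.A.mulVec ξz + ψ.B.mulVec z) (ψ.A.mulVec ξw + ψ.B.mulVec w))
        (G.A.mulVec x + G.B.mulVec w + G.Bd.mulVec d)) :
    (χ' ⬝ᵥ X.mulVec χ + χ ⬝ᵥ X.mulVec χ') + quadForm P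
      (Sum.elim (ψ.C.mulVec ξz + ψ.D.mulVec z) (ψ.C.mulVec ξw + ψ.D.mulVec w))
      + quadForm Pp (Sum.elim e d) ≤ 0 := by
  have h1 := quadForm_nonneg h.posSemidef
    (Sum.elim (Sum.elim (Sum.elim ξz ξw) x) (Sum.elim w d))
  have hadd : ∀ (Q Q' : Matrix (((σ ⊕ σ) ⊕ ν) ⊕ (Fin 1 ⊕ η)) (((σ ⊕ σ) ⊕ ν) ⊕ (Fin 1 ⊕ η)) ℝ) (v),
      quadForm (Q + Q') v = quadForm Q v + quadForm Q' v := fun Q Q' v => by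
    simp [quadForm, Matrix.add_mulVec]
  have hneg : ∀ (Q : Matrix (((σ ⊕ σ) ⊕ ν) ⊕ (Fin 1 ⊕ η)) (((σ ⊕ σ) ⊕ ν) ⊕ (Fin 1 ⊕ η)) ℝ) (v),
      quadForm (-Q) v = -quadForm Q v := fun Q v => by
    simp [quadForm, Matrix.neg_mulVec]
  rw [hneg, hadd, hadd, quadForm_congruence, quadForm_congruence, quadForm_congruence,
    outerState_mulVec ψ G ξz ξw x w d hz, outerFilter_mulVec ψ G ξz ξw x w d hz,
    outerPerf_mulVec G _ x w d he, ← hχ, ← hχ', quadForm, bilin_offDiag] at h1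
  linarith

end Loop

/-! ### Dissipation -/

section Dissipation

variable {σ p ν η ε : Type*} [Fintype σ] [DecidableEq σ] [Fintype p] [Fintype ν]
  [DecidableEq ν] [Fintype η] [DecidableEq η] [Fintype ε]

/-- Robust performance: the storage form `X` plus the terminal cost `Z = P₀ ⊗ K` decreases along
the loop and the filter at least as fast as the performance form and the certificate form
together, and the certificate form has a nonnegative integral. -/
theorem robust_performance {P₀ : Matrix (Fin 2) (Fin 2) ℝ} (hP₀ : P₀.IsSymm) (hr : P₀ 1 1 ≤ 0)
    {ψ : LinSys σ (Fin 1) p} {G : Plant ν (Fin 1) (Fin 1) η ε} {Pp : Matrix (ε ⊕ η) (ε ⊕ η) ℝ}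
    {X : Matrix ((σ ⊕ σ) ⊕ ν) ((σ ⊕ σ) ⊕ ν) ℝ} {K : Matrix σ σ ℝ} {M : Matrix p p ℝ}
    (hX : X.IsSymm) (hK : K.IsSymm) (hM : M.IsSymm) (hpos : CouplingPos X (kron P₀ K))
    (hperf : PerformanceLMI ψ.double G Pp X (kron P₀ M)) (hcert : CertificateLMI ψ K M)
    {x : ℝ → ν → ℝ} {w z : ℝ → Fin 1 → ℝ} {d : ℝ → η → ℝ} {e : ℝ → ε → ℝ}
    (h : IsLoopTrajectory G (dynUncertainty P₀) x w z d e) {T : ℝ} (hT : 0 ≤ T) :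
    quadForm (schurE X (kron P₀ K)) (x T)
      + ∫ t in (0 : ℝ)..T, quadForm Pp (Sum.elim (e t) (d t)) ≤ quadForm X.toBlocks₂₂ (x 0) := by
  obtain ⟨ξz, ξw, hξz, hξw, hξz', hξw', hξz0, hξw0, hint⟩ :=
    exists_filterStates_integral_nonneg hP₀ hr ψ h.signal_z h.w_mem
  set N := (Matrix.fromCols ψ.C ψ.D).transpose * M * Matrix.fromCols ψ.C ψ.D
      - (outerCert ψ).transpose * Matrix.fromBlocks 0 K K 0 * outerCert ψ with hN
  have hΦ := hint N (Matrix.PosDef.posSemidef hcert) T hT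
  set Φ : ℝ → ℝ := fun t => P₀ 0 0 * (Sum.elim (ξz t) (z t) ⬝ᵥ N.mulVec (Sum.elim (ξz t) (z t)))
          + 2 * P₀ 0 1 * (Sum.elim (ξz t) (z t) ⬝ᵥ N.mulVec (Sum.elim (ξw t) (w t)))
          + P₀ 1 1 * (Sum.elim (ξw t) (w t) ⬝ᵥ N.mulVec (Sum.elim (ξw t) (w t))) with hΦ_def
  set perf : ℝ → ℝ := fun t => quadForm Pp (Sum.elim (e t) (d t)) with hperf_def
  have hζz := (IsPiecewiseCont.of_continuousOn hξz).sumElim h.signal_z.isPiecewiseCont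
  have hζw := (IsPiecewiseCont.of_continuousOn hξw).sumElim h.signal_w.isPiecewiseCont
  have hΦp : IsPiecewiseCont Φ := by
    have hB := continuous_bilin N
    exact (hζz.prodMk hζw).continuous_comp
      (φ := fun a : (σ ⊕ Fin 1 → ℝ) × (σ ⊕ Fin 1 → ℝ) => P₀ 0 0 * (a.1 ⬝ᵥ N.mulVec a.1)
        + 2 * P₀ 0 1 * (a.1 ⬝ᵥ N.mulVec a.2) + P₀ 1 1 * (a.2 ⬝ᵥ N.mulVec a.2))
      (((continuous_const.mul (hB.comp (continuous_fst.prodMk continuous_fst))).add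
        (continuous_const.mul hB)).add
        (continuous_const.mul (hB.comp (continuous_snd.prodMk continuous_snd))))
  have hperfp : IsPiecewiseCont perf :=
    (h.signal_e.isPiecewiseCont.sumElim h.signal_d.isPiecewiseCont).continuous_comp
      (continuous_quadForm Pp)
  set χ : ℝ → (σ ⊕ σ) ⊕ ν → ℝ := fun t => Sum.elim (Sum.elim (ξz t) (ξw t)) (x t) with hχ
  set χ' : ℝ → (σ ⊕ σ) ⊕ ν → ℝ := fun t =>
    Sum.elim (Sum.elim (ψ.A.mulVec (ξz t) + ψ.B.mulVec (z t))
      (ψ.A.mulVec (ξw t) + ψ.B.mulVec (w t)))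
      (G.A.mulVec (x t) + G.B.mulVec (w t) + G.Bd.mulVec (d t)) with hχ'
  have hχder (t : ℝ) (ht : 0 ≤ t) : HasDerivWithinAt χ (χ' t) (Ici t) t := by
    refine hasDerivWithinAt_pi.2 fun i => ?_
    rcases i with (i | i) | i
    · exact hasDerivWithinAt_pi.1 (hξz' t ht) i
    · exact hasDerivWithinAt_pi.1 (hξw' t ht) i
    · exact hasDerivWithinAt_pi.1 (h.state_eq.hasRightDeriv t ht) i
  have hχc : ContinuousOn χ (Ici 0) := by
    refine continuousOn_pi.2 fun i => ?_
    rcases i with (i | i) | i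
    · exact continuousOn_pi.1 hξz i
    · exact continuousOn_pi.1 hξw i
    · exact continuousOn_pi.1 h.state_eq.continuousOn i
  set U : ℝ → ℝ := fun t => χ t ⬝ᵥ X.mulVec (χ t) + (P₀ 0 0 * (ξz t ⬝ᵥ K.mulVec (ξz t))
    + 2 * P₀ 0 1 * (ξz t ⬝ᵥ K.mulVec (ξw t)) + P₀ 1 1 * (ξw t ⬝ᵥ K.mulVec (ξw t))) with hU
  -- `U` is the form of the coupling matrix, i.e. of `X + diag(Z, 0)`
  have hUe (t : ℝ) : U t = quadForm (Matrix.fromBlocks (X.toBlocks₁₁ + kron P₀ K) X.toBlocks₁₂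
      X.toBlocks₁₂.transpose X.toBlocks₂₂) (χ t) := by
    rw [hχ, quadForm_coupling hX, quadForm_kron hP₀ hK]
    rfl
  have hUc : ContinuousOn U (Icc 0 T) := by
    rw [show U = _ from funext hUe]
    exact ((continuous_quadForm _).comp_continuousOn hχc).mono Icc_subset_Ici_self
  have hder (t : ℝ) (ht : 0 ≤ t) := (hasDerivWithinAt_bilin X (hχder t ht) (hχder t ht)).fun_add
    ((((hasDerivWithinAt_bilin K (hξz' t ht) (hξz' t ht)).const_mul (P₀ 0 0)).fun_add
    ((hasDerivWithinAt_bilin K (hξz' t ht) (hξw' t ht)).const_mul (2 * P₀ 0 1))).fun_add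
    ((hasDerivWithinAt_bilin K (hξw' t ht) (hξw' t ht)).const_mul (P₀ 1 1)))
  have hφp : IsPiecewiseCont (fun t => -(Φ t + perf t)) :=
    (hΦp.prodMk hperfp).continuous_comp (φ := fun a : ℝ × ℝ => -(a.1 + a.2)) (by fun_prop)
  -- the performance LMI bounds the derivative of `U` by `-(Φ + perf)`
  have key := intervalIntegral.sub_le_integral_of_hasDeriv_right_of_le hT hUc
    (fun t ht => (hder t ht.1.le).mono Ioi_subset_Ici_self)
    (φ := fun t => -(Φ t + perf t))
    ((intervalIntegrable_iff_integrableOn_Icc_of_le hT enorm_ne_top).1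
      (hφp.intervalIntegrable hT)) (fun t ht => by
      have hp := hperf.pointwise (ξz t) (ξw t) (x t) (w t) (d t) (h.z_eq t ht.1.le)
        (h.e_eq t ht.1.le) (χ := χ t) (χ' := χ' t) rfl rfl
      rw [quadForm_kron hP₀ hM] at hp
      simp only [hΦ_def, hN, certificate_bilin, hperf_def]
      linarith)
  rw [intervalIntegral.integral_neg, intervalIntegral.integral_add (hΦp.intervalIntegrable hT)
    (hperfp.intervalIntegrable hT)] at key
  have hU0 : U 0 = quadForm X.toBlocks₂₂ (x 0) := by
    rw [hUe, hχ]
    have e0 : Sum.elim (ξz 0) (ξw 0) = 0 := by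
      rw [hξz0, hξw0]
      ext (i | i) <;> rfl
    simp only [e0, quadForm, Matrix.fromBlocks_mulVec, Sum.elim_comp_inl, Sum.elim_comp_inr,
      sumElim_dotProduct_sumElim, zero_dotProduct, Matrix.mulVec_zero, zero_add]
  have hUT := hpos.quadForm_schurE_le (Sum.elim (ξz T) (ξw T)) (x T)
  have hUT' := hUe T
  simp only [hχ] at hUT'
  rw [← hUT'] at hUT
  linarith

end Dissipation

/-! ### Convexity of the feasible set -/

section Convexity

theorem convex_posDef (ι : Type*) : Convex ℝ {Q : Matrix ι ι ℝ | Q.PosDef} := by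
  intro Q hQ Q' hQ' a b ha hb hab
  rcases ha.eq_or_lt with rfl | ha
  · rw [zero_add] at hab
    simpa [hab] using hQ'
  rcases hb.eq_or_lt with rfl | hb
  · rw [add_zero] at hab
    simpa [hab] using hQ
  · exact (Matrix.PosDef.smul hQ ha).add (Matrix.PosDef.smul hQ' hb)

theorem kron_combination {ι : Type*} (P₀ : Matrix (Fin 2) (Fin 2) ℝ) (M M' : Matrix ι ι ℝ)
    (a b : ℝ) : kron P₀ (a • M + b • M') = a • kron P₀ M + b • kron P₀ M' := by
  ext i j
  simp [kron, Matrix.kronecker, Matrix.kroneckerMap]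
  ring

theorem offDiag_combination {ι : Type*} (X X' : Matrix ι ι ℝ) (a b : ℝ) :
    Matrix.fromBlocks 0 (a • X + b • X') (a • X + b • X') 0 =
      a • Matrix.fromBlocks 0 X X 0 + b • Matrix.fromBlocks 0 X' X' 0 := by
  simp [Matrix.fromBlocks_smul, Matrix.fromBlocks_add]

theorem congruence_combination {ι κ : Type*} [Fintype κ] (L : Matrix κ ι ℝ) (P P' : Matrix κ κ ℝ)
    (a b : ℝ) : L.transpose * (a • P + b • P') * L =
      a • (L.transpose * P * L) + b • (L.transpose * P' * L) := by
  simp [Matrix.mul_add, Matrix.add_mul]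

variable {σ p ν η ε : Type*} [Fintype σ] [DecidableEq σ] [Fintype p] [Fintype ν]
  [DecidableEq ν] [Fintype η] [DecidableEq η] [Fintype ε]

/-- For fixed `P₀` all conditions are affine in `(X, K, M)`. -/
theorem convex_feasibleSet (P₀ : Matrix (Fin 2) (Fin 2) ℝ) (ψ : LinSys σ (Fin 1) p)
    (G : Plant ν (Fin 1) (Fin 1) η ε) (Pp : Matrix (ε ⊕ η) (ε ⊕ η) ℝ) :
    Convex ℝ (feasibleSet P₀ ψ G Pp) := by
  rintro ⟨X, K, M⟩ ⟨hX, hK, hM, h1, h2, h3⟩ ⟨X', K', M'⟩ ⟨hX', hK', hM', h1', h2', h3'⟩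
    a b ha hb hab
  refine ⟨(hX.smul a).add (hX'.smul b), (hK.smul a).add (hK'.smul b),
    (hM.smul a).add (hM'.smul b), ?_, ?_, ?_⟩
  · have h := convex_posDef _ h1 h1' ha hb hab
    simp only [Prod.smul_mk, Prod.mk_add_mk, CouplingPos, kron_combination]
    convert (show Matrix.PosDef _ from h) using 1
    ext (i | i) (j | j) <;>
      simp [Matrix.toBlocks₁₁, Matrix.toBlocks₁₂, Matrix.toBlocks₂₂]
    ring
  · have h := convex_posDef _ h2 h2' ha hb hab
    simp only [Prod.smul_mk, Prod.mk_add_mk, PerformanceLMI, kron_combination,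
      offDiag_combination, congruence_combination]
    convert (show Matrix.PosDef _ from h) using 1
    -- the constant performance term is its own convex combination
    obtain rfl : b = 1 - a := by linarith
    module
  · have h := convex_posDef _ h3 h3' ha hb hab
    simp only [Prod.smul_mk, Prod.mk_add_mk, CertificateLMI, offDiag_combination,
      congruence_combination]
    convert (show Matrix.PosDef _ from h) using 1
    module

end Convexity

end

end RobustIQC

theorem mainTheorem2 {n nψ l nd ne : ℕ}
    (P₀ : Matrix (Fin 2) (Fin 2) ℝ) (hP₀ : P₀.IsSymm) (hr : P₀ 1 1 ≤ 0)
    (ψ : RobustIQC.LinSys (Fin nψ) (Fin 1) (Fin l))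
    (hψmin : ψ.IsMinimal) (hψstab : RobustIQC.IsHurwitz ψ.A) (hψrank : ψ.HasFullColumnRank)
    (G : RobustIQC.Plant (Fin n) (Fin 1) (Fin 1) (Fin nd) (Fin ne))
    (Pp : Matrix (Fin ne ⊕ Fin nd) (Fin ne ⊕ Fin nd) ℝ) (hPp : Pp.IsSymm)
    (hQp : Pp.toBlocks₁₁.PosSemidef) :
    (∀ (X : Matrix ((Fin nψ ⊕ Fin nψ) ⊕ Fin n) ((Fin nψ ⊕ Fin nψ) ⊕ Fin n) ℝ)
        (K : Matrix (Fin nψ) (Fin nψ) ℝ) (M : Matrix (Fin l) (Fin l) ℝ),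
        X.IsSymm → K.IsSymm → M.IsSymm →
        RobustIQC.CouplingPos X (RobustIQC.kron P₀ K) →
        RobustIQC.PerformanceLMI ψ.double G Pp X (RobustIQC.kron P₀ M) →
        RobustIQC.CertificateLMI ψ K M →
        (RobustIQC.schurE X (RobustIQC.kron P₀ K)).PosDef ∧
        ∀ (x : ℝ → Fin n → ℝ) (w z : ℝ → Fin 1 → ℝ) (d : ℝ → Fin nd → ℝ) (e : ℝ → Fin ne → ℝ),
          RobustIQC.IsLoopTrajectory G (RobustIQC.dynUncertainty P₀) x w z d e →
          ∀ T : ℝ, 0 ≤ T →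
            RobustIQC.quadForm (RobustIQC.schurE X (RobustIQC.kron P₀ K)) (x T)
              + ∫ t in (0 : ℝ)..T, RobustIQC.quadForm Pp (Sum.elim (e t) (d t))
            ≤ RobustIQC.quadForm X.toBlocks₂₂ (x 0)) ∧
    Convex ℝ (RobustIQC.feasibleSet P₀ ψ G Pp) := by
  refine ⟨fun X K M hX hK hM hpos hperf hcert => ⟨hpos.posDef_schurE, ?_⟩,
    RobustIQC.convex_feasibleSet P₀ ψ G Pp⟩
  intro x w z d e h T hT
  exact RobustIQC.robust_performance hP₀ hr hX hK hM hpos hperf hcert h hT
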